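/- Let $K$ be a field, $R=K[x_1,x_2,x_3,x_4]$, $\mathfrak m=(x_1,x_2,x_3,x_4)$, let $a_1,\dots,a_6$ be non-negative integers, and let $$I=(x_1,x_2)^{a_1}\cap(x_1,x_3)^{a_2}\cap(x_1,x_4)^{a_3}\cap(x_2,x_3)^{a_4}\cap(x_2,x_4)^{a_5}\cap(x_3,x_4)^{a_6}.$$ Assume $$(*)\qquad a_1+a_6\ \ge\ \max\{a_2+a_5,\ a_3+a_4\}.$$ Let $S$ be the set of all $y\in\mathbb N^4$ with $y_1+y_3\ge a_2$, $y_1+y_4\ge a_3$, $y_2+y_3\ge a_4$, $y_2+y_4\ge a_5$, $y_1+y_2<a_1$ and $y_3+y_4<a_6$. Let $K[S]$ be the $K$-vector space with basis $\{x^\alpha : \alpha\in S\}$, where $x^\alpha$ has degree $\alpha$, with the $R$-module structure given for $\alpha\in S$, $\beta\in\mathbb N^4$ by $x^\beta\cdot x^\alpha=x^{\beta+\alpha}$ if $\beta+\alpha\in S$, and $x^\beta\cdot x^\alpha=0$ otherwise. Let $H^1_{\mathfrak m}(R/I)=\varinjlim_t \operatorname{Ext}^1_R(R/\mathfrak m^t,R/I)$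 be the first local cohomology module. It is isomorphic as an $R$-module to the first cohomology of the Čech complex $0\to R/I\to\bigoplus_i (R/I)_{x_i}\to\bigoplus_{i<j}(R/I)_{x_ix_j}\to\cdots$, and is graded by the $\mathbb Z^4$-grading (and hence the $\mathbb Z$-grading by total degree) of that complex. Then $$H^1_{\mathfrak m}(R/I)\ \cong\ K[S]$$ as graded $R$-modules, for the $\mathbb Z^4$-gradings and hence also for the $\mathbb Z$-gradings by total degree. (This holds whichever $R$-linear isomorphism between $H^1_{\mathfrak m}(R/I)$ and the Čech cohomology is used to transport the grading.) -/

import Mathlib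

universe u

noncomputable section

open MvPolynomial

/-! ### The ideal of a tetrahedral curve (the variables `x₁,…,x₄` are `X 0,…,X 3`) -/

/-- `R = K[x₁, x₂, x₃, x₄]`. -/
abbrev PolyRing4 (K : Type u) [Field K] : Type u := MvPolynomial (Fin 4) K

/-- The maximal homogeneous ideal `𝔪 = (x₁, x₂, x₃, x₄)`. -/
def homMaxIdeal (K : Type u) [Field K] : Ideal (PolyRing4 K) :=
  Ideal.span (Set.range X)

/-- `I = (x₁,x₂)^a₁ ∩ (x₁,x₃)^a₂ ∩ (x₁,x₄)^a₃ ∩ (x₂,x₃)^a₄ ∩ (x₂,x₄)^a₅ ∩ (x₃,x₄)^a₆`. -/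
def tetrahedralIdeal (K : Type u) [Field K] (a₁ a₂ a₃ a₄ a₅ a₆ : ℕ) : Ideal (PolyRing4 K) :=
  Ideal.span {X 0, X 1} ^ a₁ ⊓ Ideal.span {X 0, X 2} ^ a₂ ⊓ Ideal.span {X 0, X 3} ^ a₃ ⊓
    Ideal.span {X 1, X 2} ^ a₄ ⊓ Ideal.span {X 1, X 3} ^ a₅ ⊓ Ideal.span {X 2, X 3} ^ a₆

/-! ### The first cohomology of the Čech complex -/

section Cech

variable (R : Type u) {A : Type u} [CommRing R] [CommRing A] [Algebra R A] {n : ℕ} (x : Fin n → A)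

/-- The canonical map `A_f → A_{fg}`. -/
def awayMulRight (f g : A) : Localization.Away f →ₐ[A] Localization.Away (f * g) :=
  IsLocalization.liftAlgHom (M := Submonoid.powers f)
    (f := Algebra.ofId A (Localization.Away (f * g)))
    (by
      rintro ⟨_, k, rfl⟩
      have h : IsUnit (algebraMap A (Localization.Away (f * g)) f) :=
        isUnit_of_mul_isUnit_left (y := algebraMap A (Localization.Away (f * g)) g)
          (by rw [← map_mul]; exact IsLocalization.Away.algebraMap_isUnit (f * g))
      simpa [Algebra.ofId_apply, map_pow] using h.pow k)

/-- The canonical map `A_g → A_{fg}`. -/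
def awayMulLeft (f g : A) : Localization.Away g →ₐ[A] Localization.Away (f * g) :=
  IsLocalization.liftAlgHom (M := Submonoid.powers g)
    (f := Algebra.ofId A (Localization.Away (f * g)))
    (by
      rintro ⟨_, k, rfl⟩
      have h : IsUnit (algebraMap A (Localization.Away (f * g)) g) :=
        isUnit_of_mul_isUnit_right (x := algebraMap A (Localization.Away (f * g)) f)
          (by rw [← map_mul]; exact IsLocalization.Away.algebraMap_isUnit (f * g))
      simpa [Algebra.ofId_apply, map_pow] using h.pow k)

/-- The first term `⨁ᵢ A_{xᵢ}` of the Čech complex `0 → A → ⨁ᵢ A_{xᵢ} → ⨁_{i<j} A_{xᵢxⱼ} → ⋯`. -/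
abbrev CechC1 : Type u := ∀ i, Localization.Away (x i)

/-- The second term `⨁_{i<j} A_{xᵢxⱼ}` of the Čech complex. -/
abbrev CechC2 : Type u :=
  ∀ p : {p : Fin n × Fin n // p.1 < p.2}, Localization.Away (x p.1.1 * x p.1.2)

/-- The differential `A → ⨁ᵢ A_{xᵢ}`, `r ↦ (r/1)ᵢ`. -/
def cechD0 : A →ₗ[R] CechC1 x :=
  LinearMap.pi fun i => (Algebra.linearMap A (Localization.Away (x i))).restrictScalars R

/-- The differential `⨁ᵢ A_{xᵢ} → ⨁_{i<j} A_{xᵢxⱼ}`, `(zᵢ)ᵢ ↦ (zⱼ - zᵢ)_{i<j}`. -/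
def cechD1 : CechC1 x →ₗ[R] CechC2 x :=
  LinearMap.pi fun p =>
    ((awayMulLeft (x p.1.1) (x p.1.2)).toLinearMap.restrictScalars R) ∘ₗ LinearMap.proj p.1.2 -
    ((awayMulRight (x p.1.1) (x p.1.2)).toLinearMap.restrictScalars R) ∘ₗ LinearMap.proj p.1.1

/-- The first cohomology `ker d¹ / im d⁰` of the Čech complex. -/
abbrev CechH1 : Type u :=
  LinearMap.ker (cechD1 R x) ⧸ (LinearMap.range (cechD0 R x)).submoduleOf (LinearMap.ker (cechD1 R x))

end Cech

/-! ### The `ℤ⁴`-grading of the Čech cohomology of `R/I`, for a monomial ideal `I` -/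

section Grading

variable {K : Type u} [Field K] (I : Ideal (PolyRing4 K))

/-- The images of the variables `x₁, …, x₄` in `R/I`. -/
def quotVar (i : Fin 4) : PolyRing4 K ⧸ I := Ideal.Quotient.mk I (X i)

/-- The component of `(R/I)_{xᵢ}` of degree `α ∈ ℤ⁴`: the `K`-span of all fractions
`x^β / xᵢ^k` of degree `β - k eᵢ = α`. -/
def awayComponent (i : Fin 4) (α : Fin 4 → ℤ) :
    Submodule K (Localization.Away (quotVar I i)) :=
  Submodule.span K {z | ∃ (k : ℕ) (β : Fin 4 →₀ ℕ),
    (∀ j, (β j : ℤ) - (if j = i then (k : ℤ) else 0) = α j) ∧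
    z = Localization.mk (Ideal.Quotient.mk I (monomial β (1 : K)))
      (⟨quotVar I i ^ k, k, rfl⟩ : Submonoid.powers (quotVar I i))}

/-- `H¹` of the Čech complex of `R/I` with respect to `x₁, …, x₄`, as an `R`-module. -/
abbrev QuotCechH1 : Type u := CechH1 (PolyRing4 K) (quotVar I)

/-- The component of `H¹` of the Čech complex of `R/I` of degree `α ∈ ℤ⁴`: the classes of the
cocycles `(zᵢ)ᵢ` all of whose entries are homogeneous of degree `α`. -/
def quotCechComponent (α : Fin 4 → ℤ) : Submodule K (QuotCechH1 I) where
  carrier := {h | ∃ z : LinearMap.ker (cechD1 (PolyRing4 K) (quotVar I)),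
    (∀ i, z.1 i ∈ awayComponent I i α) ∧ Submodule.Quotient.mk z = h}
  zero_mem' := ⟨0, fun i => (awayComponent I i α).zero_mem, rfl⟩
  add_mem' := by
    rintro _ _ ⟨z, hz, rfl⟩ ⟨w, hw, rfl⟩
    exact ⟨z + w, fun i => (awayComponent I i α).add_mem (hz i) (hw i), rfl⟩
  smul_mem' := by
    rintro c _ ⟨z, hz, rfl⟩
    exact ⟨c • z, fun i => (awayComponent I i α).smul_mem c (hz i), rfl⟩

end Grading

/-- The `ℤ`-grading by total degree that is induced by a `ℤ⁴`-grading. -/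
def totalComponent {K M : Type u} [Field K] [AddCommGroup M] [Module K M]
    (𝓜 : (Fin 4 → ℤ) → Submodule K M) (d : ℤ) : Submodule K M :=
  ⨆ α : {α : Fin 4 → ℤ // ∑ i, α i = d}, 𝓜 α.1

/-! ### The module `K[T]` for a set `T` of exponents -/

section MonomialModule

/-- `K[T]`: the `K`-vector space with basis the monomials `x^α`, `α ∈ T`. -/
def MonomialModule (K : Type u) [Field K] (T : Set (Fin 4 →₀ ℕ)) : Type u := T →₀ K

variable {K : Type u} [Field K] {T : Set (Fin 4 →₀ ℕ)}

instance : AddCommGroup (MonomialModule K T) := inferInstanceAs (AddCommGroup (T →₀ K))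

instance : Module K (MonomialModule K T) := inferInstanceAs (Module K (T →₀ K))

/-- The element `c x^α` of `K[T]`. -/
def MonomialModule.mono (α : T) : K →ₗ[K] MonomialModule K T := Finsupp.lsingle (M := K) α

theorem MonomialModule.hom_ext {N : Type*} [AddCommGroup N] [Module K N]
    {f g : MonomialModule K T →ₗ[K] N}
    (h : ∀ α c, f (MonomialModule.mono α c) = g (MonomialModule.mono α c)) : f = g :=
  Finsupp.lhom_ext h

open Classical in
/-- Multiplication by `x^β` on `K[T]`: `x^α ↦ x^(β+α)` if `β + α ∈ T`, and `x^α ↦ 0` otherwise. -/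
def MonomialModule.shift (K : Type u) [Field K] (T : Set (Fin 4 →₀ ℕ)) (β : Fin 4 →₀ ℕ) :
    MonomialModule K T →ₗ[K] MonomialModule K T :=
  Finsupp.lsum (M := K) K fun α : T =>
    if h : β + α.1 ∈ T then MonomialModule.mono (⟨β + α.1, h⟩ : T) else 0

open Classical in
theorem MonomialModule.shift_mono (β : Fin 4 →₀ ℕ) (α : T) (c : K) :
    MonomialModule.shift K T β (MonomialModule.mono α c) =
      if h : β + α.1 ∈ T then MonomialModule.mono ⟨β + α.1, h⟩ c else 0 := by
  unfold MonomialModule.shift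
  refine (Finsupp.lsum_single (M := K) K _ α c).trans ?_
  by_cases h : β + α.1 ∈ T
  · rw [dif_pos h, dif_pos h]
  · rw [dif_neg h, dif_neg h]
    rfl

/-- The multiplications by monomials, as an action of the monoid of monomials. This needs that
`α, γ + β + α ∈ T` implies `β + α ∈ T`. -/
def MonomialModule.shiftHom (K : Type u) [Field K] (T : Set (Fin 4 →₀ ℕ)) [hT : T.OrdConnected] :
    Multiplicative (Fin 4 →₀ ℕ) →* Module.End K (MonomialModule K T) where
  toFun β := MonomialModule.shift K T β.toAdd
  map_one' := by
    refine MonomialModule.hom_ext fun α c => ?_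
    rw [MonomialModule.shift_mono]
    simp
  map_mul' γ β := by
    refine MonomialModule.hom_ext fun α c => ?_
    rw [Module.End.mul_apply, MonomialModule.shift_mono, MonomialModule.shift_mono]
    by_cases h : β.toAdd + α.1 ∈ T
    · rw [dif_pos h, MonomialModule.shift_mono]
      have h' : (γ * β).toAdd + α.1 = γ.toAdd + (β.toAdd + α.1) := by rw [toAdd_mul, add_assoc]
      by_cases h2 : γ.toAdd + (β.toAdd + α.1) ∈ T
      · rw [dif_pos h2, dif_pos (h' ▸ h2)]
        simp only [h']
      · rw [dif_neg h2, dif_neg (h' ▸ h2)]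
    · rw [dif_neg h, map_zero, dif_neg]
      intro h'
      refine h (hT.out α.2 h' ⟨le_add_self, ?_⟩)
      rw [toAdd_mul, add_assoc]
      exact le_add_self

/-- The `R`-module structure of `K[T]`, where a polynomial acts through its monomials. -/
instance [T.OrdConnected] : Module (PolyRing4 K) (MonomialModule K T) :=
  Module.compHom (MonomialModule K T)
    (AddMonoidAlgebra.lift K (Module.End K (MonomialModule K T)) (Fin 4 →₀ ℕ)
      (MonomialModule.shiftHom K T) : PolyRing4 K →ₐ[K] _).toRingHom

open Classical in
/-- `x^β · x^α = x^(β+α)` if `β + α ∈ T`, and `0` otherwise. -/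
theorem MonomialModule.monomial_smul_mono [T.OrdConnected] (β : Fin 4 →₀ ℕ) (b : K) (α : T)
    (c : K) :
    (monomial β b : PolyRing4 K) • (MonomialModule.mono α c : MonomialModule K T) =
      if h : β + α.1 ∈ T then MonomialModule.mono ⟨β + α.1, h⟩ (b * c) else 0 := by
  have h1 : (monomial β b : PolyRing4 K) • (MonomialModule.mono α c : MonomialModule K T) =
      b • MonomialModule.shift K T β (MonomialModule.mono α c) := by
    change (AddMonoidAlgebra.lift K _ _ (MonomialModule.shiftHom K T)
      (AddMonoidAlgebra.single β b)) _ = _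
    rw [AddMonoidAlgebra.lift_single]
    rfl
  rw [h1, MonomialModule.shift_mono]
  split_ifs
  · rw [← map_smul, smul_eq_mul]
  · simp

/-- The component of `K[T]` of degree `α ∈ ℤ⁴`: `K x^α` if `α ∈ T`, and `0` otherwise. -/
def MonomialModule.component (K : Type u) [Field K] (T : Set (Fin 4 →₀ ℕ)) (α : Fin 4 → ℤ) :
    Submodule K (MonomialModule K T) :=
  Submodule.span K {m | ∃ β : T, (∀ j, (β.1 j : ℤ) = α j) ∧ m = MonomialModule.mono β 1}

end MonomialModule

/-- The set `S` of all `y ∈ ℕ⁴` with `y₁+y₃ ≥ a₂`, `y₁+y₄ ≥ a₃`, `y₂+y₃ ≥ a₄`, `y₂+y₄ ≥ a₅`,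
`y₁+y₂ < a₁` and `y₃+y₄ < a₆`. -/
def tetrahedralSet (a₁ a₂ a₃ a₄ a₅ a₆ : ℕ) : Set (Fin 4 →₀ ℕ) :=
  {y | a₂ ≤ y 0 + y 2 ∧ a₃ ≤ y 0 + y 3 ∧ a₄ ≤ y 1 + y 2 ∧ a₅ ≤ y 1 + y 3 ∧
    y 0 + y 1 < a₁ ∧ y 2 + y 3 < a₆}

instance (a₁ a₂ a₃ a₄ a₅ a₆ : ℕ) : (tetrahedralSet a₁ a₂ a₃ a₄ a₅ a₆).OrdConnected where
  out' := by
    rintro x ⟨h1, h2, h3, h4, -, -⟩ z ⟨-, -, -, -, h5, h6⟩ y ⟨hx, hz⟩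
    have hx0 := hx 0
    have hx1 := hx 1
    have hx2 := hx 2
    have hx3 := hx 3
    have hz0 := hz 0
    have hz1 := hz 1
    have hz2 := hz 2
    have hz3 := hz 3
    refine ⟨?_, ?_, ?_, ?_, ?_, ?_⟩ <;> omega

/-! ### The first local cohomology module of `R/I` -/

section LocalCohomology

variable {K : Type u} [Field K] (I : Ideal (PolyRing4 K))

/-- The local cohomology module `H¹_𝔪(R/I) = colim_t Ext¹_R(R/𝔪^t, R/I)`. -/
abbrev LocalH1 : Type u :=
  (localCohomology (homMaxIdeal K) 1).obj (ModuleCat.of (PolyRing4 K) (PolyRing4 K ⧸ I))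

end LocalCohomology

end

/-!
The proof has two independent halves: local cohomology is identified with Čech cohomology in
degree one, and the Čech cohomology of `R/I` is computed one multidegree at a time.

**Local cohomology.** A projective resolution `P` of `R/J` gives `Ext¹(R/J, M) ≅ Hom(J, M) / M`:
if `e ∈ P₀` lifts `1 ∈ R/J` and `f : P₁ → M` is a cocycle, the map `J → M` sends `r` to the value
of `f` at any point over `r e`. This is natural in `J` (`extOneEquiv`, `extOneEquiv_map`), so that
local cohomology is the colimit of the modules `Hom(Jᵗ, A) / A`. For `J = (y₁, …, yₙ)` a linear map
`c : Jᵗ → A` gives the Čech cocycle `(c(yᵢᵗ) / yᵢᵗ)ᵢ`. A map whose cocycle is a coboundary is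
multiplication by an element on a smaller power of `J` (`exists_homQuotRestrict_eq_zero`), and by
the Artin–Rees lemma every cocycle arises (`homQuotToCech_jointly_surjective`). Hence the colimit is
the first Čech cohomology of any finite algebra `A` over a noetherian ring
(`localCohomologyEquivCech`).

**Čech cohomology of `R/I`.** A cocycle can be written as `(fᵢ / xᵢᴺ)ᵢ` with
`xᵢᴺ fⱼ - xⱼᴺ fᵢ ∈ I`, and membership in the monomial ideal `I` is read off from the coefficients.
In a fixed degree `β` a cocycle is a family of scalars `gᵢ`, indexed by the `i` for which `x^β` is
nonzero at `xᵢ`, with `gᵢ = gⱼ` if `x^β` is nonzero at `xᵢ xⱼ`. The latter means that `x^β` is not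
in the power of `(xₖ, xₗ)` in `I`, where `{i, j, k, l} = {1, 2, 3, 4}`. If `β` has a negative
entry, all `gᵢ` vanish (`coeff_eq_zero_of_compatible`). Otherwise cohomology is the quotient of the
functions on the connected components with an edge of a graph on four vertices by the constants. It
is nonzero only if the graph is a perfect matching; the inequality between the `aᵢ` excludes two of
the three matchings, and the third, with edges `12` and `34`, occurs for `β ∈ S` and contributes the
class of `(0, 0, x^β, x^β)` (`exists_gluing`, `exists_quotFrac_eq`). So `sideClass` is a bijection
`K[S] → H¹`; it is linear and compatible with the gradings because the coefficients of the preimage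
of a cocycle are explicit (`exists_eq_sideClass`). In the code the variables `x₁, …, x₄` are
numbered from `0` to `3`.
-/

noncomputable section

open MvPolynomial

/-! ### `Ext¹(R/J, M)` as the quotient of `Hom(J, M)` by `M` -/

section HomQuot

variable {R : Type u} [CommRing R] (J : Ideal R) (M : Type u) [AddCommGroup M] [Module R M]

/-- The map `M → Hom(J, M)` that sends `m` to `r ↦ r • m`. -/
def smulHom : M →ₗ[R] (J →ₗ[R] M) :=
  LinearMap.lcomp R M J.subtype ∘ₗ (LinearMap.lsmul R M).flip

@[simp]
theorem smulHom_apply (m : M) (r : J) : smulHom J M m r = (r : R) • m := rfl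

/-- The cokernel of `M = Hom(R, M) → Hom(J, M)`, which is isomorphic to `Ext¹(R/J, M)`. -/
abbrev HomQuot : Type u := (J →ₗ[R] M) ⧸ LinearMap.range (smulHom J M)

variable {J M} {P₀ P₁ P₂ : Type u} [AddCommGroup P₀] [Module R P₀] [AddCommGroup P₁] [Module R P₁]
  [AddCommGroup P₂] [Module R P₂] {d₂ : P₂ →ₗ[R] P₁} {d₁ : P₁ →ₗ[R] P₀} {π : P₀ →ₗ[R] R ⧸ J}

theorem smul_mem_range_of_exact (h₀ : Function.Exact d₁ π) (e : P₀) {r : R} (hr : r ∈ J) :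
    r • e ∈ LinearMap.range d₁ := by
  rw [LinearMap.mem_range, ← Set.mem_range, ← h₀, map_smul]
  obtain ⟨s, hs⟩ := Ideal.Quotient.mk_surjective (π e)
  rw [← hs]
  change Ideal.Quotient.mk J (r * s) = 0
  exact Ideal.Quotient.eq_zero_iff_mem.2 (J.mul_mem_right s hr)

variable (M) in
/-- For an exact sequence `P₂ → P₁ → P₀ → R/J` and `e ∈ P₀`, a cocycle `f : P₁ → M` gives the map
`J → M` that sends `r` to `f p` for any `p ∈ P₁` over `r • e`. -/
def evalCocycle (h₁ : Function.Exact d₂ d₁) (h₀ : Function.Exact d₁ π) (e : P₀) :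
    LinearMap.ker (LinearMap.lcomp R M d₂) →ₗ[R] (J →ₗ[R] M) where
  toFun f := (LinearMap.ker d₁).liftQ f.1 (by
      intro p hp
      obtain ⟨q, rfl⟩ := (h₁ p).1 hp
      exact LinearMap.congr_fun f.2 q) ∘ₗ d₁.quotKerEquivRange.symm.toLinearMap ∘ₗ
    (LinearMap.toSpanSingleton R P₀ e ∘ₗ J.subtype).codRestrict (LinearMap.range d₁)
      fun r => smul_mem_range_of_exact h₀ e r.2
  map_add' f g := by
    ext r
    obtain ⟨p, hp⟩ := smul_mem_range_of_exact h₀ e r.2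
    have : d₁.quotKerEquivRange.symm ⟨(r : R) • e, smul_mem_range_of_exact h₀ e r.2⟩ =
        Submodule.Quotient.mk p := by
      rw [LinearEquiv.symm_apply_eq]
      exact Subtype.ext hp.symm
    simp [LinearMap.codRestrict, this]
  map_smul' c f := by
    ext r
    obtain ⟨p, hp⟩ := smul_mem_range_of_exact h₀ e r.2
    have : d₁.quotKerEquivRange.symm ⟨(r : R) • e, smul_mem_range_of_exact h₀ e r.2⟩ =
        Submodule.Quotient.mk p := by
      rw [LinearEquiv.symm_apply_eq]
      exact Subtype.ext hp.symm
    simp [LinearMap.codRestrict, this]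

theorem evalCocycle_apply (h₁ : Function.Exact d₂ d₁) (h₀ : Function.Exact d₁ π) {e : P₀}
    (f : LinearMap.ker (LinearMap.lcomp R M d₂)) {r : J} {p : P₁} (hp : d₁ p = (r : R) • e) :
    evalCocycle M h₁ h₀ e f r = f.1 p := by
  have : d₁.quotKerEquivRange.symm ⟨(r : R) • e, smul_mem_range_of_exact h₀ e r.2⟩ =
      Submodule.Quotient.mk p := by
    rw [LinearEquiv.symm_apply_eq]
    exact Subtype.ext hp.symm
  simp [evalCocycle, LinearMap.codRestrict, this]

/-- A coboundary `g ∘ d₁` evaluates to the map `r ↦ r • g e`. -/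
theorem evalCocycle_comp (h₁ : Function.Exact d₂ d₁) (h₀ : Function.Exact d₁ π) (e : P₀)
    (g : P₀ →ₗ[R] M) (f : LinearMap.ker (LinearMap.lcomp R M d₂)) (hf : f.1 = g ∘ₗ d₁) :
    evalCocycle M h₁ h₀ e f = smulHom J M (g e) := by
  ext r
  obtain ⟨p, hp⟩ := smul_mem_range_of_exact h₀ e r.2
  rw [evalCocycle_apply h₁ h₀ f hp, hf, LinearMap.comp_apply, hp, map_smul, smulHom_apply]

/-- Up to the maps `r ↦ r • m`, the evaluation does not depend on the lift `e` of `1 ∈ R/J`. -/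
theorem evalCocycle_sub_mem (h₁ : Function.Exact d₂ d₁) (h₀ : Function.Exact d₁ π) {e e' : P₀}
    (he : π e = π e') (f : LinearMap.ker (LinearMap.lcomp R M d₂)) :
    evalCocycle M h₁ h₀ e f - evalCocycle M h₁ h₀ e' f ∈ LinearMap.range (smulHom J M) := by
  obtain ⟨q, hq⟩ := (h₀ (e - e')).1 (by rw [map_sub, he, sub_self])
  refine ⟨f.1 q, ?_⟩
  ext r
  obtain ⟨p, hp⟩ := smul_mem_range_of_exact h₀ e r.2
  have hp' : d₁ (p - (r : R) • q) = (r : R) • e' := by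
    rw [map_sub, map_smul, hp, hq, ← smul_sub, sub_sub_cancel]
  rw [LinearMap.sub_apply, evalCocycle_apply h₁ h₀ f hp, evalCocycle_apply h₁ h₀ f hp', map_sub,
    map_smul, sub_sub_cancel, smulHom_apply]

/-- A projective `P₀` over `R/J` maps to `R` over `R/J`. -/
theorem exists_lift_to_ring [Module.Projective R P₀] (π : P₀ →ₗ[R] R ⧸ J) :
    ∃ η : P₀ →ₗ[R] R, ∀ p, Ideal.Quotient.mk J (η p) = π p := by
  obtain ⟨η, hη⟩ := Module.projective_lifting_property J.mkQ π J.mkQ_surjective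
  exact ⟨η, fun p => LinearMap.congr_fun hη p⟩

theorem exists_eq_comp_of_evalCocycle [Module.Projective R P₀] (h₁ : Function.Exact d₂ d₁)
    (h₀ : Function.Exact d₁ π) {e : P₀} (he : π e = 1)
    (f : LinearMap.ker (LinearMap.lcomp R M d₂))
    (hf : evalCocycle M h₁ h₀ e f ∈ LinearMap.range (smulHom J M)) :
    ∃ g : P₀ →ₗ[R] M, f.1 = g ∘ₗ d₁ := by
  obtain ⟨m, hm⟩ := hf
  obtain ⟨η, hη⟩ := exists_lift_to_ring π
  -- the projection `p ↦ p - η p • e` of `P₀` onto `im d₁` lifts to `P₁`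
  have hmem : ∀ p, p - η p • e ∈ LinearMap.range d₁ := fun p => by
    rw [LinearMap.mem_range, ← Set.mem_range, ← h₀, map_sub, map_smul, he, ← hη]
    change _ - Ideal.Quotient.mk J (η p * 1) = 0
    rw [mul_one, sub_self]
  obtain ⟨s, hs⟩ := Module.projective_lifting_property d₁.rangeRestrict
    ((LinearMap.id - LinearMap.toSpanSingleton R P₀ e ∘ₗ η).codRestrict (LinearMap.range d₁) hmem)
    d₁.surjective_rangeRestrict
  have hs' : ∀ p, d₁ (s p) = p - η p • e := fun p => congrArg Subtype.val (LinearMap.congr_fun hs p)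
  refine ⟨f.1 ∘ₗ s + LinearMap.toSpanSingleton R M m ∘ₗ η, ?_⟩
  ext q
  have hJ : η (d₁ q) ∈ J := by
    rw [← Ideal.Quotient.eq_zero_iff_mem, hη]
    exact (h₀ _).2 ⟨q, rfl⟩
  have h1 := evalCocycle_apply h₁ h₀ (e := e) f (r := ⟨η (d₁ q), hJ⟩) (p := q - s (d₁ q))
    (by rw [map_sub, hs', sub_sub_cancel])
  rw [← hm, smulHom_apply, map_sub] at h1
  simp only [LinearMap.comp_apply, LinearMap.add_apply, LinearMap.toSpanSingleton_apply]
  rw [h1]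
  abel

theorem exists_evalCocycle_sub_mem [Module.Projective R P₀] (h₁ : Function.Exact d₂ d₁)
    (h₀ : Function.Exact d₁ π) {e : P₀} (he : π e = 1) (c : J →ₗ[R] M) :
    ∃ f, evalCocycle M h₁ h₀ e f - c ∈ LinearMap.range (smulHom J M) := by
  obtain ⟨η, hη⟩ := exists_lift_to_ring π
  have hJ : ∀ q, η (d₁ q) ∈ J := fun q => by
    rw [← Ideal.Quotient.eq_zero_iff_mem, hη]
    exact (h₀ _).2 ⟨q, rfl⟩
  have he' : η e - 1 ∈ J := by
    rw [← Ideal.Quotient.eq_zero_iff_mem, map_sub, hη, he, map_one, sub_self]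
  let f : P₁ →ₗ[R] M := c ∘ₗ (η ∘ₗ d₁).codRestrict J hJ
  refine ⟨⟨f, ?_⟩, c ⟨η e - 1, he'⟩, ?_⟩
  · ext q
    have : d₁ (d₂ q) = 0 := (h₁ _).2 ⟨q, rfl⟩
    change c ⟨η (d₁ (d₂ q)), _⟩ = 0
    rw [← map_zero c]
    congr 1
    exact Subtype.ext (by simp [this])
  · ext r
    obtain ⟨p, hp⟩ := smul_mem_range_of_exact h₀ e r.2
    rw [LinearMap.sub_apply, evalCocycle_apply h₁ h₀ _ hp, smulHom_apply, ← map_smul]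
    change _ = c ⟨η (d₁ p), _⟩ - _
    rw [← map_sub]
    congr 1
    refine Subtype.ext ?_
    simp [hp, mul_sub]

end HomQuot

section ExtOne

open CategoryTheory

variable {R : Type u} [CommRing R]

/-- The map of complexes `Hom(Q, M) → Hom(P, M)` induced by a map of complexes `P → Q`. -/
def linearYonedaObjMap {P Q : ChainComplex (ModuleCat.{u} R) ℕ} (φ : P ⟶ Q)
    (M : ModuleCat.{u} R) : Q.linearYonedaObj R M ⟶ P.linearYonedaObj R M :=
  (HomologicalComplex.unopFunctor _ _).map
    ((((linearYoneda R (ModuleCat.{u} R)).obj M).rightOp.mapHomologicalComplex _).map φ).op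

theorem linearYonedaObj_d_apply {P : ChainComplex (ModuleCat.{u} R) ℕ} (M : ModuleCat.{u} R)
    (i j : ℕ) (g : P.X i ⟶ M) : (P.linearYonedaObj R M).d i j g = P.d j i ≫ g := rfl

theorem trans_symm_hom_comp {C : Type*} [Category* C] {X Y Z : C} (e : X ≅ Y) (e' : Z ≅ Y) :
    (e ≪≫ e'.symm).hom ≫ e'.hom = e.hom := by simp

/-- The computation of `Ext` by projective resolutions is natural in the first argument. -/
theorem ext_map_isoExt {X Y : ModuleCat.{u} R} (f : X ⟶ Y) (P : ProjectiveResolution X)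
    (Q : ProjectiveResolution Y) (φ : P.complex ⟶ Q.complex)
    (comm : φ.f 0 ≫ Q.π.f 0 = P.π.f 0 ≫ f) (n : ℕ) (M : ModuleCat.{u} R) :
    ((Ext R (ModuleCat.{u} R) n).map f.op).app M ≫ (P.isoExt n M).hom =
      (Q.isoExt n M).hom ≫ HomologicalComplex.homologyMap (linearYonedaObjMap φ M) n := by
  have h := congrArg Quiver.Hom.unop (ProjectiveResolution.isoLeftDerivedObj_inv_naturality f P Q
    φ comm ((linearYoneda R (ModuleCat.{u} R)).obj M).rightOp n)
  simp only [unop_comp] at h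
  have h2 := congrArg Quiver.Hom.unop
    (HomologicalComplex.homologyOp_hom_naturality (linearYonedaObjMap φ M) n)
  have key : ∀ {X : ModuleCat.{u} R} (P : ProjectiveResolution X), (P.isoExt n M).hom ≫
      ((P.complex.linearYonedaObj R M).homologyOp n).hom.unop =
      (P.isoLeftDerivedObj ((linearYoneda R (ModuleCat.{u} R)).obj M).rightOp n).inv.unop :=
    fun P => trans_symm_hom_comp
      (P.isoLeftDerivedObj ((linearYoneda R (ModuleCat.{u} R)).obj M).rightOp n).unop.symm
      (HomologicalComplex.homologyUnop
        ((((linearYoneda R (ModuleCat.{u} R)).obj M).rightOp.mapHomologicalComplex _).obj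
          P.complex) n)
  rw [← cancel_mono (((P.complex.linearYonedaObj R M).homologyOp n).hom.unop), Category.assoc,
    Category.assoc, key P]
  refine h.trans ?_
  exact (congrArg (· ≫ _) (key Q).symm).trans
    ((Category.assoc _ _ _).trans (congrArg ((Q.isoExt n M).hom ≫ ·) h2))

end ExtOne

section ExtOne

open CategoryTheory

variable {R : Type u} [CommRing R]

theorem hom_apply_of_comp_eq {X Y Z : ModuleCat.{u} R} {f : X ⟶ Y} {g : Y ⟶ Z} {h : X ⟶ Z}
    (H : f ≫ g = h) (x : X) : g (f x) = h x := by
  rw [← H]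
  rfl

section

variable {X : ModuleCat.{u} R} (P : ProjectiveResolution X)

/-- The augmentation `P₀ → X` of a projective resolution, as a linear map. -/
def augmentation : P.complex.X 0 →ₗ[R] X :=
  (show P.complex.X 0 ⟶ X from P.π.f 0).hom

theorem exact_d_d : Function.Exact (P.complex.d 2 1).hom (P.complex.d 1 0).hom := by
  have h := P.complex_exactAt_succ 0
  rw [HomologicalComplex.exactAt_iff' _ 2 1 0 (by simp) (by simp)] at h
  exact (ShortComplex.ShortExact.moduleCat_exact_iff_function_exact _).1 h

theorem exact_d_augmentation : Function.Exact (P.complex.d 1 0).hom (augmentation P) :=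
  (ShortComplex.ShortExact.moduleCat_exact_iff_function_exact _).1 P.exact₀

theorem augmentation_surjective : Function.Surjective (augmentation P) :=
  (ModuleCat.epi_iff_surjective (P.π.f 0)).1 inferInstance

instance (n : ℕ) : Module.Projective R (P.complex.X n) :=
  (IsProjective.iff_projective _).2 (P.projective n)

variable (M : ModuleCat.{u} R)

/-- A cycle of degree one of `Hom(P, M)`, as a cocycle `P₁ → M`. -/
def cycleToCocycle : (P.complex.linearYonedaObj R M).cycles 1 →ₗ[R]
    LinearMap.ker (LinearMap.lcomp R M (P.complex.d 2 1).hom) :=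
  ((ModuleCat.homLinearEquiv (S := R)).toLinearMap ∘ₗ
    ((P.complex.linearYonedaObj R M).iCycles 1).hom).codRestrict _ fun c => by
      have h : (P.complex.linearYonedaObj R M).d 1 2
          ((P.complex.linearYonedaObj R M).iCycles 1 c) = 0 :=
        hom_apply_of_comp_eq ((P.complex.linearYonedaObj R M).iCycles_d 1 2) c
      exact congrArg (@ModuleCat.Hom.hom R _ (P.complex.X 2) M) h

theorem cycleToCocycle_surjective : Function.Surjective (cycleToCocycle P M) := by
  intro f
  let K := P.complex.linearYonedaObj R M
  let k : ModuleCat.of R R ⟶ K.X 1 := ModuleCat.ofHom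
    (LinearMap.toSpanSingleton R (P.complex.X 1 ⟶ M) (ModuleCat.ofHom f.1))
  have hk : k ≫ K.d 1 2 = 0 := by
    ext
    refine (linearYonedaObj_d_apply M 1 2 ((1 : R) • ModuleCat.ofHom f.1)).trans ?_
    rw [one_smul]
    refine ModuleCat.hom_ext ?_
    exact f.2
  refine ⟨K.liftCycles k 2 (by simp) hk (1 : R), Subtype.ext ?_⟩
  refine (congrArg (@ModuleCat.Hom.hom R _ (P.complex.X 1) M)
    (hom_apply_of_comp_eq (K.liftCycles_i k 2 (by simp) hk) (1 : R))).trans ?_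
  change ModuleCat.Hom.hom ((1 : R) • ModuleCat.ofHom f.1) = _
  rw [one_smul]
  rfl

theorem cycleToCocycle_toCycles (g : P.complex.X 0 ⟶ M) :
    (cycleToCocycle P M ((P.complex.linearYonedaObj R M).toCycles 0 1 g)).1 =
      g.hom ∘ₗ (P.complex.d 1 0).hom :=
  congrArg (@ModuleCat.Hom.hom R _ (P.complex.X 1) M)
    (hom_apply_of_comp_eq ((P.complex.linearYonedaObj R M).toCycles_i 0 1) g)

theorem cycleToCocycle_injective : Function.Injective (cycleToCocycle P M) := by
  intro c c' h
  apply (ModuleCat.mono_iff_injective ((P.complex.linearYonedaObj R M).iCycles 1)).1 inferInstance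
  exact ModuleCat.hom_ext (congrArg Subtype.val h)

end

variable {J : Ideal R} (P : ProjectiveResolution (ModuleCat.of R (R ⧸ J))) (M : ModuleCat.{u} R)

/-- The evaluation of the cycles of `Hom(P, M)` on `e ∈ P₀`, for a projective resolution `P` of
`R/J`, with values in `Hom(J, M) / M`. -/
def cyclesToHomQuot (e : P.complex.X 0) :
    (P.complex.linearYonedaObj R M).cycles 1 ⟶ ModuleCat.of R (HomQuot J M) :=
  ModuleCat.ofHom ((LinearMap.range (smulHom J M)).mkQ ∘ₗ
    evalCocycle M (exact_d_d P) (exact_d_augmentation P) e ∘ₗ cycleToCocycle P M)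

theorem toCycles_cyclesToHomQuot (e : P.complex.X 0) :
    (P.complex.linearYonedaObj R M).toCycles 0 1 ≫ cyclesToHomQuot P M e = 0 := by
  ext g
  exact (Submodule.Quotient.mk_eq_zero _).2 ⟨_, (evalCocycle_comp (exact_d_d P)
    (exact_d_augmentation P) e _ _ (cycleToCocycle_toCycles P M g)).symm⟩

/-- The map `H¹(Hom(P, M)) → Hom(J, M) / M` induced by the evaluation of cocycles on `e ∈ P₀`. -/
def homologyToHomQuot (e : P.complex.X 0) :
    (P.complex.linearYonedaObj R M).homology 1 ⟶ ModuleCat.of R (HomQuot J M) :=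
  ((P.complex.linearYonedaObj R M).homologyIsCokernel 0 1 (by simp)).desc
    (Limits.CokernelCofork.ofπ _ (toCycles_cyclesToHomQuot P M e))

theorem homologyToHomQuot_π (e : P.complex.X 0) (c : (P.complex.linearYonedaObj R M).cycles 1) :
    homologyToHomQuot P M e ((P.complex.linearYonedaObj R M).homologyπ 1 c) =
      Submodule.Quotient.mk (evalCocycle M (exact_d_d P) (exact_d_augmentation P) e
        (cycleToCocycle P M c)) :=
  hom_apply_of_comp_eq (((P.complex.linearYonedaObj R M).homologyIsCokernel 0 1 (by simp)).fac
    (Limits.CokernelCofork.ofπ _ (toCycles_cyclesToHomQuot P M e))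
    Limits.WalkingParallelPair.one) c

theorem homologyπ_surjective :
    Function.Surjective ((P.complex.linearYonedaObj R M).homologyπ 1) :=
  (ModuleCat.epi_iff_surjective _).1 inferInstance

theorem homologyToHomQuot_bijective {e : P.complex.X 0} (he : augmentation P e = (1 : R ⧸ J)) :
    Function.Bijective (homologyToHomQuot P M e) := by
  constructor
  · rw [injective_iff_map_eq_zero]
    intro z hz
    obtain ⟨c, rfl⟩ := homologyπ_surjective P M z
    rw [homologyToHomQuot_π, Submodule.Quotient.mk_eq_zero] at hz
    obtain ⟨g, hg⟩ := exists_eq_comp_of_evalCocycle _ _ he _ hz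
    have : c = (P.complex.linearYonedaObj R M).toCycles 0 1 (ModuleCat.ofHom g) :=
      cycleToCocycle_injective P M
        (Subtype.ext (hg.trans (cycleToCocycle_toCycles P M (ModuleCat.ofHom g)).symm))
    rw [this]
    exact hom_apply_of_comp_eq ((P.complex.linearYonedaObj R M).toCycles_comp_homologyπ 0 1)
      (ModuleCat.ofHom g)
  · intro q
    obtain ⟨c, rfl⟩ := Submodule.Quotient.mk_surjective _ q
    obtain ⟨f, hf⟩ := exists_evalCocycle_sub_mem (exact_d_d P) (exact_d_augmentation P) he c
    obtain ⟨z, rfl⟩ := cycleToCocycle_surjective P M f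
    refine ⟨(P.complex.linearYonedaObj R M).homologyπ 1 z, ?_⟩
    rw [homologyToHomQuot_π]
    exact (Submodule.Quotient.eq _).2 hf

variable (J) in
/-- A lift of `1 ∈ R/J` to the degree zero part of the chosen projective resolution of `R/J`. -/
def liftOne : (projectiveResolution (ModuleCat.of R (R ⧸ J))).complex.X 0 :=
  (augmentation_surjective (projectiveResolution (ModuleCat.of R (R ⧸ J))) (1 : R ⧸ J)).choose

variable (J) in
theorem augmentation_liftOne : augmentation _ (liftOne J) = (1 : R ⧸ J) :=
  (augmentation_surjective (projectiveResolution (ModuleCat.of R (R ⧸ J))) (1 : R ⧸ J)).choose_spec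

variable (J) in
/-- The isomorphism `Ext¹(R/J, M) ≅ Hom(J, M) / M`. -/
def extOneEquiv : ((Ext R (ModuleCat.{u} R) 1).obj
    (Opposite.op (ModuleCat.of R (R ⧸ J)))).obj M ≃ₗ[R] HomQuot J M :=
  ((projectiveResolution (ModuleCat.of R (R ⧸ J))).isoExt 1 M).toLinearEquiv ≪≫ₗ
    LinearEquiv.ofBijective (homologyToHomQuot (projectiveResolution _) M (liftOne J)).hom
      (homologyToHomQuot_bijective _ M (augmentation_liftOne J))

/-- The restriction `Hom(J, M) / M → Hom(J', M) / M` for `J' ≤ J`. -/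
def homQuotRestrict {J' : Ideal R} (h : J' ≤ J) (M : Type u) [AddCommGroup M] [Module R M] :
    HomQuot J M →ₗ[R] HomQuot J' M :=
  Submodule.mapQ _ _ (LinearMap.lcomp R M (Submodule.inclusion h)) (by
    rintro _ ⟨m, rfl⟩
    exact ⟨m, rfl⟩)

/-- `Ext¹(R/J, M) ≅ Hom(J, M) / M` is natural in `J`. -/
theorem extOneEquiv_map {J' : Ideal R} (h : J' ≤ J)
    (z : ((Ext R (ModuleCat.{u} R) 1).obj (Opposite.op (ModuleCat.of R (R ⧸ J)))).obj M) :
    extOneEquiv J' M (((Ext R (ModuleCat.{u} R) 1).map (Quiver.Hom.op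
      (ModuleCat.ofHom (Submodule.mapQ J' J LinearMap.id h) :
        ModuleCat.of R (R ⧸ J') ⟶ ModuleCat.of R (R ⧸ J)))).app M z) =
      homQuotRestrict h M (extOneEquiv J M z) := by
  set f : ModuleCat.of R (R ⧸ J') ⟶ ModuleCat.of R (R ⧸ J) :=
    ModuleCat.ofHom (Submodule.mapQ J' J LinearMap.id h)
  set P := projectiveResolution (ModuleCat.of R (R ⧸ J'))
  set Q := projectiveResolution (ModuleCat.of R (R ⧸ J))
  let φ := ProjectiveResolution.lift f P Q
  have comm : φ.f 0 ≫ Q.π.f 0 = P.π.f 0 ≫ f := ProjectiveResolution.lift_commutes_zero f P Q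
  have h1 := congrArg (fun k => k.hom z) (ext_map_isoExt f P Q φ comm 1 M)
  change homologyToHomQuot P M (liftOne J') ((P.isoExt 1 M).hom _) =
    homQuotRestrict h M (homologyToHomQuot Q M (liftOne J) ((Q.isoExt 1 M).hom z))
  refine (congrArg (homologyToHomQuot P M (liftOne J')) h1).trans ?_
  change homologyToHomQuot P M (liftOne J') (HomologicalComplex.homologyMap
    (linearYonedaObjMap φ M) 1 ((Q.isoExt 1 M).hom z)) = _
  obtain ⟨c, hc⟩ := homologyπ_surjective Q M ((Q.isoExt 1 M).hom z)
  rw [← hc, hom_apply_of_comp_eq (HomologicalComplex.homologyπ_naturality _ _) c,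
    ConcreteCategory.comp_apply, homologyToHomQuot_π, homologyToHomQuot_π]
  have haug : augmentation Q ((φ.f 0).hom (liftOne J')) = augmentation Q (liftOne J) := by
    have h2 : augmentation Q ((φ.f 0).hom (liftOne J')) = f.hom (augmentation P (liftOne J')) :=
      congrArg (fun k => k.hom (liftOne J')) comm
    rw [h2]
    refine Eq.trans ?_ (augmentation_liftOne J).symm
    exact congrArg f.hom (augmentation_liftOne J')
  have hsub := evalCocycle_sub_mem (exact_d_d Q) (exact_d_augmentation Q) haug
    (cycleToCocycle Q M c)
  rw [← (Submodule.Quotient.eq _).2 hsub]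
  refine congrArg Submodule.Quotient.mk ?_
  ext r
  obtain ⟨p, hp⟩ := smul_mem_range_of_exact (exact_d_augmentation P) (liftOne J') r.2
  have hp' : (Q.complex.d 1 0).hom ((φ.f 1).hom p) = (r : R) • (φ.f 0).hom (liftOne J') := by
    rw [← map_smul, ← hp]
    exact congrArg (fun k => k.hom p) (φ.comm 1 0)
  rw [evalCocycle_apply _ _ _ hp]
  refine Eq.trans ?_ (evalCocycle_apply (exact_d_d Q) (exact_d_augmentation Q)
    (cycleToCocycle Q M c) (r := Submodule.inclusion h r) hp').symm
  have h3 := hom_apply_of_comp_eq (HomologicalComplex.cyclesMap_i (linearYonedaObjMap φ M) 1) c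
  exact congrArg (fun k => (@ModuleCat.Hom.hom R _ (P.complex.X 1) M k) p) h3

end ExtOne

/-! ### Fractions and Čech cocycles -/

section Fractions

variable {A : Type u} [CommRing A]

/-- The fraction `a / f ^ k` in `A_f`. -/
def frac (f a : A) (k : ℕ) : Localization.Away f :=
  Localization.mk a (⟨f ^ k, k, rfl⟩ : Submonoid.powers f)

theorem frac_eq_mk' (f a : A) (k : ℕ) :
    frac f a k =
      IsLocalization.mk' (Localization.Away f) a (⟨f ^ k, k, rfl⟩ : Submonoid.powers f) :=
  Localization.mk_eq_mk'_apply _ _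

theorem exists_frac (f : A) (z : Localization.Away f) : ∃ a k, z = frac f a k := by
  induction z using Localization.induction_on with
  | H p =>
    obtain ⟨a, ⟨_, k, rfl⟩⟩ := p
    exact ⟨a, k, rfl⟩

theorem frac_eq_zero_iff {f a : A} {k : ℕ} : frac f a k = 0 ↔ ∃ m, f ^ m * a = 0 := by
  rw [frac_eq_mk', IsLocalization.mk'_eq_zero_iff]
  constructor
  · rintro ⟨⟨_, m, rfl⟩, h⟩
    exact ⟨m, h⟩
  · rintro ⟨m, h⟩
    exact ⟨⟨_, m, rfl⟩, h⟩

theorem frac_pow_mul (f a : A) (k m : ℕ) : frac f (f ^ m * a) (m + k) = frac f a k := by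
  rw [frac, frac, Localization.mk_eq_mk_iff, Localization.r_iff_exists]
  exact ⟨1, by simp only [pow_add]; ring⟩

theorem frac_add (f a b : A) (k : ℕ) : frac f (a + b) k = frac f a k + frac f b k := by
  simp only [frac, Localization.add_mk_self]

theorem frac_zero (f : A) (k : ℕ) : frac f 0 k = 0 :=
  frac_eq_zero_iff.2 ⟨0, by simp⟩

theorem frac_sub (f a b : A) (k : ℕ) : frac f (a - b) k = frac f a k - frac f b k := by
  rw [eq_sub_iff_add_eq, ← frac_add, sub_add_cancel]

theorem smul_frac {R : Type*} [CommSemiring R] [Algebra R A] (r : R) (f a : A) (k : ℕ) :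
    r • frac f a k = frac f (r • a) k :=
  Localization.smul_mk _ _ _

theorem frac_self_pow_mul (f a : A) (k : ℕ) : frac f (f ^ k * a) k = algebraMap A _ a := by
  have h := frac_pow_mul f a 0 k
  rw [add_zero] at h
  rw [h, frac_eq_mk']
  simp [IsLocalization.mk'_eq_iff_eq_mul]

theorem awayMulLeft_frac (f g a : A) (k : ℕ) :
    awayMulLeft f g (frac g a k) = frac (f * g) (f ^ k * a) k := by
  have h1 : awayMulLeft f g (frac g a k) * awayMulLeft f g (algebraMap A _ (g ^ k)) =
      algebraMap A _ a := by
    rw [← map_mul, frac_eq_mk', ← AlgHom.commutes (awayMulLeft f g)]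
    congr 1
    exact IsLocalization.mk'_spec (Localization.Away g) a (⟨g ^ k, k, rfl⟩ : Submonoid.powers g)
  rw [AlgHom.commutes] at h1
  rw [frac_eq_mk' (f * g), IsLocalization.eq_mk'_iff_mul_eq]
  simp only [mul_pow, map_mul] at h1 ⊢
  rw [← h1]
  ring

theorem awayMulRight_frac (f g a : A) (k : ℕ) :
    awayMulRight f g (frac f a k) = frac (f * g) (g ^ k * a) k := by
  have h1 : awayMulRight f g (frac f a k) * awayMulRight f g (algebraMap A _ (f ^ k)) =
      algebraMap A _ a := by
    rw [← map_mul, frac_eq_mk', ← AlgHom.commutes (awayMulRight f g)]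
    congr 1
    exact IsLocalization.mk'_spec (Localization.Away f) a (⟨f ^ k, k, rfl⟩ : Submonoid.powers f)
  rw [AlgHom.commutes] at h1
  rw [frac_eq_mk' (f * g), IsLocalization.eq_mk'_iff_mul_eq]
  simp only [mul_pow, map_mul] at h1 ⊢
  rw [← h1]
  ring

end Fractions

section Cocycles

variable {R : Type u} {A : Type u} [CommRing R] [CommRing A] [Algebra R A] {n : ℕ} {x : Fin n → A}

theorem exists_frac_common (z : CechC1 x) :
    ∃ (N : ℕ) (a : Fin n → A), ∀ i, z i = frac (x i) (a i) N := by
  choose a k h using fun i => exists_frac (x i) (z i)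
  refine ⟨∑ i, k i, fun i => x i ^ (∑ j, k j - k i) * a i, fun i => ?_⟩
  have hk : k i ≤ ∑ j, k j :=
    Finset.single_le_sum (fun j _ => Nat.zero_le (k j)) (Finset.mem_univ i)
  rw [h i, ← frac_pow_mul (x i) (a i) (k i) (∑ j, k j - k i), Nat.sub_add_cancel hk]

theorem cechD1_frac (a : Fin n → A) (N : ℕ) (p : {p : Fin n × Fin n // p.1 < p.2}) :
    cechD1 R x (fun i => frac (x i) (a i) N) p =
      frac (x p.1.1 * x p.1.2) (x p.1.1 ^ N * a p.1.2 - x p.1.2 ^ N * a p.1.1) N := by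
  rw [frac_sub, ← awayMulLeft_frac, ← awayMulRight_frac]
  rfl

theorem frac_mem_ker {a : Fin n → A} {N : ℕ} (h : ∀ i j, x i ^ N * a j = x j ^ N * a i) :
    (fun i => frac (x i) (a i) N : CechC1 x) ∈ LinearMap.ker (cechD1 R x) := by
  rw [LinearMap.mem_ker]
  funext p
  rw [cechD1_frac, h, sub_self, frac_zero]
  rfl

/-- After multiplying numerators and denominators by powers of the variables, the cocycle condition
holds for the numerators themselves. -/
theorem exists_compatible {z : CechC1 x} (hz : z ∈ LinearMap.ker (cechD1 R x)) {a : Fin n → A}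
    {N : ℕ} (ha : ∀ i, z i = frac (x i) (a i) N) :
    ∃ M, (∀ i, z i = frac (x i) (x i ^ M * a i) (M + N)) ∧
      ∀ i j, x i ^ (M + N) * (x j ^ M * a j) = x j ^ (M + N) * (x i ^ M * a i) := by
  obtain rfl : z = fun i => frac (x i) (a i) N := funext ha
  have h : ∀ p : {p : Fin n × Fin n // p.1 < p.2}, ∃ m, (x p.1.1 * x p.1.2) ^ m *
      (x p.1.1 ^ N * a p.1.2 - x p.1.2 ^ N * a p.1.1) = 0 := by
    intro p
    rw [← frac_eq_zero_iff (k := N), ← cechD1_frac (R := R), LinearMap.mem_ker.1 hz]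
    rfl
  choose m hm using h
  let M := ∑ p, m p
  have key : ∀ i j, i < j →
      x i ^ (M + N) * (x j ^ M * a j) = x j ^ (M + N) * (x i ^ M * a i) := by
    intro i j hij
    have hle : m ⟨(i, j), hij⟩ ≤ M :=
      Finset.single_le_sum (fun p _ => Nat.zero_le (m p)) (Finset.mem_univ _)
    obtain ⟨q, hq⟩ := Nat.exists_eq_add_of_le hle
    have h1 : (x i * x j) ^ m ⟨(i, j), hij⟩ * (x i ^ N * a j - x j ^ N * a i) = 0 :=
      hm ⟨(i, j), hij⟩
    have h2 : (x i * x j) ^ M * (x i ^ N * a j - x j ^ N * a i) = 0 := by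
      rw [hq, pow_add, mul_right_comm, h1, zero_mul]
    rw [← sub_eq_zero, ← h2]
    ring
  refine ⟨M, fun i => (frac_pow_mul _ _ _ _).symm, fun i j => ?_⟩
  rcases lt_trichotomy i j with hij | rfl | hij
  · exact key i j hij
  · rfl
  · exact (key j i hij).symm

end Cocycles

/-! ### Local cohomology and Čech cohomology in degree one -/

section Comparison

variable {R : Type u} {A : Type u} [CommRing R] [CommRing A] [Algebra R A] {n : ℕ} {y : Fin n → R}
  {x : Fin n → A}

theorem pow_mem_span_range_pow (y : Fin n → R) (i : Fin n) (t : ℕ) :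
    y i ^ t ∈ Ideal.span (Set.range y) ^ t :=
  Ideal.pow_mem_pow (Ideal.subset_span (Set.mem_range_self i)) t

theorem exists_span_pow_le (y : Fin n → R) (s : ℕ) :
    ∃ p, Ideal.span (Set.range y) ^ p ≤ Ideal.span (Set.range fun i => y i ^ s) := by
  refine Ideal.exists_pow_le_of_le_radical_of_fg (Ideal.span_le.2 ?_)
    (Submodule.fg_span (Set.finite_range y))
  rintro _ ⟨i, rfl⟩
  exact ⟨s, Ideal.subset_span ⟨i, rfl⟩⟩

/-- The Čech cocycle `(c(yᵢᵗ) / xᵢᵗ)ᵢ` of a linear map `c : (y₁, …, yₙ)ᵗ → A`, where `xᵢ` is the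
image of `yᵢ` in `A`. -/
def cechOfHom (hx : ∀ i, x i = algebraMap R A (y i)) (t : ℕ) :
    (↥(Ideal.span (Set.range y) ^ t) →ₗ[R] A) →ₗ[R] LinearMap.ker (cechD1 R x) where
  toFun c := ⟨fun i => frac (x i) (c ⟨y i ^ t, pow_mem_span_range_pow y i t⟩) t,
    frac_mem_ker fun i j => by
      rw [hx, hx, ← map_pow, ← map_pow, ← Algebra.smul_def, ← Algebra.smul_def, ← map_smul,
        ← map_smul]
      congr 1
      exact Subtype.ext (mul_comm _ _)⟩
  map_add' c c' := by
    ext i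
    exact frac_add _ _ _ _
  map_smul' r c := by
    ext i
    exact (smul_frac _ _ _ _).symm

theorem cechOfHom_apply (hx : ∀ i, x i = algebraMap R A (y i)) (t : ℕ)
    (c : ↥(Ideal.span (Set.range y) ^ t) →ₗ[R] A) (i : Fin n) :
    (cechOfHom hx t c).1 i = frac (x i) (c ⟨y i ^ t, pow_mem_span_range_pow y i t⟩) t := rfl

theorem cechOfHom_smulHom (hx : ∀ i, x i = algebraMap R A (y i)) (t : ℕ) (m : A) :
    (cechOfHom hx t (smulHom _ A m)).1 = cechD0 R x m := by
  funext i
  rw [cechOfHom_apply, smulHom_apply, Algebra.smul_def, map_pow, ← hx, frac_self_pow_mul]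
  rfl

/-- The map `Hom(Jᵗ, A) / A → H¹` induced by `cechOfHom`, for `J = (y₁, …, yₙ)`. -/
def homQuotToCech (hx : ∀ i, x i = algebraMap R A (y i)) (t : ℕ) :
    HomQuot (Ideal.span (Set.range y) ^ t) A →ₗ[R] CechH1 R x :=
  Submodule.mapQ _ _ (cechOfHom hx t) (by
    rintro _ ⟨m, rfl⟩
    exact ⟨m, (cechOfHom_smulHom hx t m).symm⟩)

theorem homQuotToCech_restrict (hx : ∀ i, x i = algebraMap R A (y i)) {t t' : ℕ} (h : t ≤ t')
    (q : HomQuot (Ideal.span (Set.range y) ^ t) A) :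
    homQuotToCech hx t' (homQuotRestrict (Ideal.pow_le_pow_right h) A q) =
      homQuotToCech hx t q := by
  obtain ⟨c, rfl⟩ := Submodule.Quotient.mk_surjective _ q
  obtain ⟨s, rfl⟩ := Nat.exists_eq_add_of_le' h
  refine congrArg Submodule.Quotient.mk (Subtype.ext (funext fun i => ?_))
  rw [cechOfHom_apply, cechOfHom_apply, ← frac_pow_mul (x i) _ t s, hx i, ← map_pow,
    ← Algebra.smul_def, ← map_smul]
  change frac _ (c _) _ = _
  congr 2
  exact Subtype.ext (pow_add _ _ _)

theorem exists_homQuotRestrict_eq_zero (hx : ∀ i, x i = algebraMap R A (y i)) {t : ℕ}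
    {q : HomQuot (Ideal.span (Set.range y) ^ t) A} (hq : homQuotToCech hx t q = 0) :
    ∃ (t' : ℕ) (h : t ≤ t'), homQuotRestrict (Ideal.pow_le_pow_right h) A q = 0 := by
  obtain ⟨c, rfl⟩ := Submodule.Quotient.mk_surjective _ q
  obtain ⟨m, hm⟩ := (Submodule.Quotient.mk_eq_zero _).1 hq
  rw [Submodule.subtype_apply, ← cechOfHom_smulHom hx t] at hm
  have h1 : ∀ i, ∃ k, x i ^ k * ((smulHom (Ideal.span (Set.range y) ^ t) A m - c)
      ⟨y i ^ t, pow_mem_span_range_pow y i t⟩) = 0 :=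
    fun i => by
      rw [← frac_eq_zero_iff (k := t), LinearMap.sub_apply, frac_sub, sub_eq_zero]
      exact congrFun hm i
  choose k hk using h1
  obtain ⟨p, hp⟩ := exists_span_pow_le y (∑ i, k i + t)
  have hle : Ideal.span (Set.range fun i => y i ^ (∑ i, k i + t)) ≤
      Submodule.map (Submodule.subtype _) (LinearMap.ker (smulHom _ A m - c)) := by
    refine Ideal.span_le.2 ?_
    rintro _ ⟨i, rfl⟩
    obtain ⟨d, hd⟩ := Nat.exists_eq_add_of_le'
      (Finset.single_le_sum (fun j _ => Nat.zero_le (k j)) (Finset.mem_univ i))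
    refine ⟨y i ^ (∑ i, k i) • ⟨y i ^ t, pow_mem_span_range_pow y i t⟩, ?_, (pow_add _ _ _).symm⟩
    rw [SetLike.mem_coe, LinearMap.mem_ker, map_smul, Algebra.smul_def, map_pow, ← hx, hd, pow_add,
      mul_assoc, hk, mul_zero]
  refine ⟨p + t, Nat.le_add_left _ _, (Submodule.Quotient.mk_eq_zero _).2 ⟨m, ?_⟩⟩
  ext r
  obtain ⟨r', hr', hr⟩ := hle (hp (Ideal.pow_le_pow_right (Nat.le_add_right p t) r.2))
  have h2 : r' = Submodule.inclusion (Ideal.pow_le_pow_right (Nat.le_add_left t p)) r :=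
    Subtype.ext hr
  rw [h2] at hr'
  exact sub_eq_zero.1 hr'

/-- Every Čech cocycle `(aᵢ / xᵢᴺ)ᵢ` comes from a linear map on a power of `J = (y₁, …, yₙ)`. The
pairs `(yᵢᴺ, aᵢ)` generate a submodule `G` of `R × A` whose intersection with `0 × A` is killed by a
power of `J`; by the Artin–Rees lemma `Jˢ G` then meets `0 × A` trivially for large `s`, so that it
is the graph of a linear map. -/
theorem homQuotToCech_jointly_surjective [IsNoetherianRing R] [Module.Finite R A]
    (hx : ∀ i, x i = algebraMap R A (y i)) (h : CechH1 R x) :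
    ∃ t q, homQuotToCech (R := R) hx t q = h := by
  obtain ⟨⟨z, hz⟩, rfl⟩ := Submodule.Quotient.mk_surjective _ h
  obtain ⟨N₀, a₀, ha₀⟩ := exists_frac_common z
  obtain ⟨M, ha', hcomp'⟩ := exists_compatible hz ha₀
  obtain ⟨N, a, ha, hcomp⟩ : ∃ (N : ℕ) (a : Fin n → A), (∀ i, z i = frac (x i) (a i) N) ∧
      ∀ i j, x i ^ N * a j = x j ^ N * a i := ⟨_, _, ha', hcomp'⟩
  let J := Ideal.span (Set.range y)
  let G : Submodule R (R × A) := Submodule.span R (Set.range fun i => (y i ^ N, a i))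
  -- `yⱼᴺ • w = w.1 • (yⱼᴺ, aⱼ)` in the second component
  have hG : ∀ j, ∀ w ∈ G, y j ^ N • w.2 = w.1 • a j := by
    intro j w hw
    induction hw using Submodule.span_induction with
    | mem w hw =>
      obtain ⟨i, rfl⟩ := hw
      simp only [Algebra.smul_def, map_pow, ← hx]
      exact hcomp j i
    | zero => simp
    | add v w _ _ hv hw => rw [Prod.snd_add, Prod.fst_add, smul_add, add_smul, hv, hw]
    | smul r w _ hw => rw [Prod.smul_snd, Prod.smul_fst, smul_comm, hw, smul_assoc]
  let V : Submodule R G := LinearMap.ker (LinearMap.fst R R A ∘ₗ G.subtype)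
  obtain ⟨p, hp⟩ := exists_span_pow_le y N
  have hV : J ^ p • V = ⊥ := by
    rw [eq_bot_iff]
    refine (Submodule.smul_mono_left hp).trans (Submodule.smul_le.2 ?_)
    intro r hr w hw
    have hw1 : w.1.1 = 0 := hw
    have hle : Ideal.span (Set.range fun i => y i ^ N) ≤
        LinearMap.ker (LinearMap.toSpanSingleton R A w.1.2) := by
      refine Ideal.span_le.2 ?_
      rintro _ ⟨j, rfl⟩
      change y j ^ N • w.1.2 = 0
      rw [hG j w.1 w.2, hw1, zero_smul]
    have hr' : r • w.1.2 = 0 := hle hr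
    rw [Submodule.mem_bot]
    refine Subtype.ext (Prod.ext ?_ hr')
    change r * w.1.1 = 0
    rw [hw1, mul_zero]
  obtain ⟨k, hk⟩ := Ideal.exists_pow_inf_eq_pow_smul J V
  have hinf : J ^ (k + p) • (⊤ : Submodule R G) ⊓ V = ⊥ := by
    rw [hk (k + p) (Nat.le_add_right k p), Nat.add_sub_cancel_left, eq_bot_iff, ← hV]
    exact Submodule.smul_mono le_rfl inf_le_right
  let g : Submodule R (R × A) := Submodule.map G.subtype (J ^ (k + p) • ⊤)
  have hg : ∀ w ∈ g, w.1 = 0 → w.2 = 0 := by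
    rintro _ ⟨w, hw, rfl⟩ h0
    have : w ∈ J ^ (k + p) • (⊤ : Submodule R G) ⊓ V := ⟨hw, h0⟩
    rw [hinf, Submodule.mem_bot] at this
    rw [this]
    rfl
  have hmem : ∀ r ∈ J ^ (k + p), ∀ i, (r * y i ^ N, r • a i) ∈ g := fun r hr i =>
    ⟨r • ⟨(y i ^ N, a i), Submodule.subset_span ⟨i, rfl⟩⟩,
      Submodule.smul_mem_smul hr Submodule.mem_top, rfl⟩
  have hdom : J ^ (k + p + p + N) ≤ g.toLinearPMap.domain := by
    rw [Submodule.toLinearPMap_domain]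
    refine (Ideal.pow_le_pow_right (Nat.le_add_right _ N)).trans ?_
    rw [pow_add _ (k + p)]
    refine (Ideal.mul_mono_right hp).trans (Ideal.mul_le.2 fun r hr s hs => ?_)
    have hle : Ideal.span (Set.range fun i => y i ^ N) ≤
        Submodule.comap (LinearMap.lsmul R R r) (Submodule.map (LinearMap.fst R R A) g) := by
      refine Ideal.span_le.2 ?_
      rintro _ ⟨j, rfl⟩
      exact ⟨_, hmem r hr j, rfl⟩
    exact hle hs
  refine ⟨k + p + p + N, Submodule.Quotient.mk (g.toLinearPMap.toFun ∘ₗ Submodule.inclusion hdom),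
    congrArg Submodule.Quotient.mk (Subtype.ext (funext fun i => ?_))⟩
  rw [cechOfHom_apply]
  change _ = z i
  rw [ha, ← frac_pow_mul (x i) (a i) N (k + p + p), hx i, ← map_pow, ← Algebra.smul_def]
  congr 1
  have h1 := Submodule.mem_graph_toLinearPMap hg
    (Submodule.inclusion hdom ⟨y i ^ (k + p + p + N), pow_mem_span_range_pow y i _⟩)
  have h2 := hmem (y i ^ (k + p + p))
    (Ideal.pow_le_pow_right (Nat.le_add_right _ _) (pow_mem_span_range_pow y i _)) i
  rw [← pow_add] at h2
  have h3 := hg _ (g.sub_mem h1 h2) (sub_self _)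
  exact sub_eq_zero.1 h3

end Comparison

section Colimit

open CategoryTheory Limits

variable {R : Type u} {A : Type u} [CommRing R] [CommRing A] [Algebra R A] {n : ℕ} {y : Fin n → R}
  {x : Fin n → A}

/-- The system of the `Ext¹(R/Jᵗ, A)` for `J = (y₁, …, yₙ)`. -/
abbrev extOneDiagram (A : Type u) [CommRing A] [Algebra R A] (y : Fin n → R) :
    ℕᵒᵖᵒᵖ ⥤ ModuleCat.{u} R :=
  localCohomology.diagram (localCohomology.idealPowersDiagram (Ideal.span (Set.range y))) 1 ⋙
    (evaluation _ _).obj (ModuleCat.of R A)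

/-- The maps from `Ext¹(R/Jᵗ, A)` to Čech cohomology, as a cocone. -/
def cechCocone (hx : ∀ i, x i = algebraMap R A (y i)) : Cocone (extOneDiagram A y) where
  pt := ModuleCat.of R (CechH1 R x)
  ι :=
    { app := fun j => ModuleCat.ofHom (homQuotToCech hx j.unop.unop ∘ₗ
        (extOneEquiv (Ideal.span (Set.range y) ^ j.unop.unop) (ModuleCat.of R A)).toLinearMap)
      naturality := fun j j' f => by
        ext z
        refine (congrArg (homQuotToCech hx j'.unop.unop) (extOneEquiv_map (ModuleCat.of R A)
          (Ideal.pow_le_pow_right f.unop.unop.down.down) z)).trans ?_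
        exact homQuotToCech_restrict hx f.unop.unop.down.down _ }

/-- The colimit cocone that defines local cohomology. -/
def localCohomologyIsColimit (A : Type u) [CommRing A] [Algebra R A] (y : Fin n → R) :
    IsColimit (((evaluation _ _).obj (ModuleCat.of R A)).mapCocone (colimit.cocone
      (localCohomology.diagram
        (localCohomology.idealPowersDiagram (Ideal.span (Set.range y))) 1))) :=
  isColimitOfPreserves _ (colimit.isColimit _)

theorem desc_cechCocone_bijective [IsNoetherianRing R] [Module.Finite R A]
    (hx : ∀ i, x i = algebraMap R A (y i)) :
    Function.Bijective ((localCohomologyIsColimit A y).desc (cechCocone hx)) := by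
  have hfac := (localCohomologyIsColimit A y).fac (cechCocone hx)
  constructor
  · rw [injective_iff_map_eq_zero]
    intro z hz
    have : PreservesFilteredColimitsOfSize.{0, 0} (forget (ModuleCat.{u} R)) :=
      preservesFilteredColimitsOfSize_shrink _
    obtain ⟨j, w, rfl⟩ := Concrete.isColimit_exists_rep _ (localCohomologyIsColimit A y) z
    rw [hom_apply_of_comp_eq (hfac j)] at hz
    obtain ⟨t', h, h0⟩ := exists_homQuotRestrict_eq_zero hx hz
    let f : j ⟶ Opposite.op (Opposite.op t') := (homOfLE h).op.op
    have h1 : (extOneDiagram A y).map f w = 0 := by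
      apply (extOneEquiv (Ideal.span (Set.range y) ^ t') (ModuleCat.of R A)).injective
      refine Eq.trans ?_ (map_zero _).symm
      exact (extOneEquiv_map (ModuleCat.of R A) (Ideal.pow_le_pow_right h) w).trans h0
    rw [← hom_apply_of_comp_eq (Cocone.w _ f) w, h1, map_zero]
  · intro h
    obtain ⟨t, q, rfl⟩ := homQuotToCech_jointly_surjective (R := R) hx h
    refine ⟨_, (hom_apply_of_comp_eq (hfac (Opposite.op (Opposite.op t)))
      ((extOneEquiv (Ideal.span (Set.range y) ^ t) (ModuleCat.of R A)).symm q)).trans ?_⟩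
    exact congrArg (homQuotToCech hx t) (LinearEquiv.apply_symm_apply _ q)

/-- The first local cohomology module of a finite algebra `A` over a noetherian ring with support in
`(y₁, …, yₙ)` is the first Čech cohomology module. -/
def localCohomologyEquivCech [IsNoetherianRing R] [Module.Finite R A]
    (hx : ∀ i, x i = algebraMap R A (y i)) :
    (localCohomology (Ideal.span (Set.range y)) 1).obj (ModuleCat.of R A) ≃ₗ[R] CechH1 R x :=
  LinearEquiv.ofBijective ((localCohomologyIsColimit A y).desc (cechCocone hx)).hom
    (desc_cechCocone_bijective hx)

end Colimit

/-! ### Monomial ideals -/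

section MonomialIdeals

variable {K : Type u} [Field K]

theorem coeff_add_single_X_pow_mul {σ : Type*} (i : σ) (N : ℕ) (d : σ →₀ ℕ)
    (p : MvPolynomial σ K) : coeff (d + Finsupp.single i N) (X i ^ N * p) = coeff d p := by
  rw [X_pow_eq_monomial, add_comm, coeff_monomial_mul, one_mul]

theorem coeff_X_pow_mul_of_lt {σ : Type*} {i : σ} {N : ℕ} {d : σ →₀ ℕ} (h : d i < N)
    (p : MvPolynomial σ K) : coeff d (X i ^ N * p) = 0 := by
  classical
  rw [X_pow_eq_monomial, coeff_monomial_mul', if_neg]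
  intro hle
  have := hle i
  rw [Finsupp.single_eq_same] at this
  exact absurd this (not_le.2 h)

theorem exists_eq_add_single {σ : Type*} {i : σ} {N : ℕ} {d : σ →₀ ℕ} (h : N ≤ d i) :
    ∃ e, d = e + Finsupp.single i N := by
  refine ⟨d - Finsupp.single i N, (tsub_add_cancel_of_le ?_).symm⟩
  rwa [Finsupp.single_le_iff]

/-- A polynomial lies in `(xᵢ, xⱼ)ᵃ` iff each of its monomials has degree at least `a` in
`xᵢ, xⱼ`. -/
theorem mem_span_pair_pow_iff {σ : Type*} {i j : σ} (hij : i ≠ j) (a : ℕ)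
    (p : MvPolynomial σ K) :
    p ∈ (Ideal.span {X i, X j} : Ideal (MvPolynomial σ K)) ^ a ↔
      ∀ d, d i + d j < a → coeff d p = 0 := by
  classical
  constructor
  · induction a generalizing p with
    | zero => intro _ d hd; omega
    | succ a ih =>
      intro hp
      rw [pow_succ] at hp
      induction hp using Submodule.mul_induction_on' with
      | mem_mul_mem r hr s hs =>
        obtain ⟨u, v, rfl⟩ := Ideal.mem_span_pair.1 hs
        have key : ∀ k, k = i ∨ k = j → ∀ w d, d i + d j < a + 1 → coeff d (r * (w * X k)) = 0 := by
          intro k hk w d hd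
          have hwr : r * w ∈ (Ideal.span {X i, X j} : Ideal (MvPolynomial σ K)) ^ a :=
            Ideal.mul_mem_right _ _ hr
          rw [← mul_assoc, mul_comm, ← pow_one (X k)]
          by_cases hdk : d k < 1
          · exact coeff_X_pow_mul_of_lt hdk _
          · obtain ⟨e, rfl⟩ := exists_eq_add_single (not_lt.1 hdk)
            rw [coeff_add_single_X_pow_mul]
            refine ih _ hwr e ?_
            simp only [Finsupp.add_apply] at hd
            rcases hk with rfl | rfl
            · rw [Finsupp.single_eq_same] at hd
              omega
            · rw [Finsupp.single_eq_same] at hd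
              omega
        intro d hd
        rw [mul_add, coeff_add, key i (Or.inl rfl) u d hd, key j (Or.inr rfl) v d hd, add_zero]
      | add p _ q _ hp hq =>
        intro d hd
        rw [coeff_add, hp d hd, hq d hd, add_zero]
  · intro h
    rw [p.as_sum]
    refine Ideal.sum_mem _ fun d hd => ?_
    have hda : a ≤ d i + d j := not_lt.1 fun hlt => mem_support_iff.1 hd (h d hlt)
    obtain ⟨e, he⟩ := exists_eq_add_single (le_refl (d i))
    have hej : d j ≤ e j := by
      have := DFunLike.congr_fun he j
      rw [Finsupp.add_apply, Finsupp.single_eq_of_ne hij.symm, add_zero] at this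
      exact this.le
    obtain ⟨e', he'⟩ := exists_eq_add_single hej
    have hd' : Finsupp.single i (d i) + Finsupp.single j (d j) + e' = d := by
      conv_rhs => rw [he, he']
      rw [add_comm, add_assoc, add_comm (Finsupp.single i _)]
    have hm : monomial d (coeff d p) = X i ^ d i * X j ^ d j * monomial e' (coeff d p) := by
      rw [X_pow_eq_monomial, X_pow_eq_monomial, monomial_mul, monomial_mul, one_mul, one_mul, hd']
    rw [hm]
    refine Ideal.mul_mem_right _ _ (Ideal.pow_le_pow_right hda ?_)
    rw [pow_add]
    exact Ideal.mul_mem_mul (Ideal.pow_mem_pow (Ideal.subset_span (by simp)) _)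
      (Ideal.pow_mem_pow (Ideal.subset_span (by simp)) _)

theorem mem_tetrahedralIdeal_iff (a₁ a₂ a₃ a₄ a₅ a₆ : ℕ) (p : PolyRing4 K) :
    p ∈ tetrahedralIdeal K a₁ a₂ a₃ a₄ a₅ a₆ ↔ ∀ d : Fin 4 →₀ ℕ,
      (d 0 + d 1 < a₁ ∨ d 0 + d 2 < a₂ ∨ d 0 + d 3 < a₃ ∨ d 1 + d 2 < a₄ ∨ d 1 + d 3 < a₅ ∨
        d 2 + d 3 < a₆) → coeff d p = 0 := by
  simp only [tetrahedralIdeal, Ideal.mem_inf]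
  rw [mem_span_pair_pow_iff (by decide), mem_span_pair_pow_iff (by decide),
    mem_span_pair_pow_iff (by decide), mem_span_pair_pow_iff (by decide),
    mem_span_pair_pow_iff (by decide), mem_span_pair_pow_iff (by decide)]
  constructor
  · rintro ⟨⟨⟨⟨⟨h1, h2⟩, h3⟩, h4⟩, h5⟩, h6⟩ d (h | h | h | h | h | h)
    exacts [h1 d h, h2 d h, h3 d h, h4 d h, h5 d h, h6 d h]
  · intro H
    exact ⟨⟨⟨⟨⟨fun d h => H d (.inl h), fun d h => H d (.inr (.inl h))⟩,
      fun d h => H d (.inr (.inr (.inl h)))⟩, fun d h => H d (.inr (.inr (.inr (.inl h))))⟩,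
      fun d h => H d (.inr (.inr (.inr (.inr (.inl h)))))⟩,
      fun d h => H d (.inr (.inr (.inr (.inr (.inr h)))))⟩

/-- The fraction `p / xᵢᴺ` in the localization of `R/I` at `xᵢ`. -/
abbrev quotFrac (I : Ideal (PolyRing4 K)) (i : Fin 4) (p : PolyRing4 K) (N : ℕ) :
    Localization.Away (quotVar I i) :=
  frac (quotVar I i) (Ideal.Quotient.mk I p) N

theorem quotFrac_eq_zero_iff {I : Ideal (PolyRing4 K)} {i : Fin 4} {p : PolyRing4 K} {N : ℕ} :
    quotFrac I i p N = 0 ↔ ∃ m, X i ^ m * p ∈ I := by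
  rw [quotFrac, frac_eq_zero_iff]
  simp only [quotVar, ← map_pow, ← map_mul, Ideal.Quotient.eq_zero_iff_mem]

theorem quotFrac_pow_mul (I : Ideal (PolyRing4 K)) (i : Fin 4) (p : PolyRing4 K) (N m : ℕ) :
    quotFrac I i (X i ^ m * p) (m + N) = quotFrac I i p N := by
  rw [quotFrac, map_mul, map_pow]
  exact frac_pow_mul _ _ _ _

theorem quotFrac_sub (I : Ideal (PolyRing4 K)) (i : Fin 4) (p q : PolyRing4 K) (N : ℕ) :
    quotFrac I i (p - q) N = quotFrac I i p N - quotFrac I i q N := by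
  rw [quotFrac, map_sub, frac_sub]

theorem quotFrac_add (I : Ideal (PolyRing4 K)) (i : Fin 4) (p q : PolyRing4 K) (N : ℕ) :
    quotFrac I i (p + q) N = quotFrac I i p N + quotFrac I i q N := by
  rw [quotFrac, map_add, frac_add]

end MonomialIdeals

section Lift

variable {K : Type u} [Field K] {T : Set (Fin 4 →₀ ℕ)}

/-- The inclusion of `K[T]` into the polynomial ring, which is not a map of modules over the
polynomial ring. -/
def MonomialModule.toPoly (K : Type u) [Field K] (T : Set (Fin 4 →₀ ℕ)) :
    MonomialModule K T →ₗ[K] PolyRing4 K :=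
  Finsupp.lsum (M := K) K fun α : T => monomial α.1

theorem MonomialModule.toPoly_mono (α : T) (c : K) :
    toPoly K T (mono α c) = monomial α.1 c :=
  Finsupp.lsum_single (M := K) K _ α c

theorem MonomialModule.coeff_toPoly_of_notMem (v : MonomialModule K T) {γ : Fin 4 →₀ ℕ}
    (hγ : γ ∉ T) : coeff γ (toPoly K T v) = 0 := by
  classical
  have : lcoeff K γ ∘ₗ toPoly K T = 0 := MonomialModule.hom_ext fun α c => by
    rw [LinearMap.comp_apply, toPoly_mono, lcoeff_apply, coeff_monomial, if_neg]
    · rfl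
    · rintro rfl
      exact hγ α.2
  exact LinearMap.congr_fun this v

theorem MonomialModule.coeff_toPoly (v : MonomialModule K T) (γ : T) :
    coeff γ.1 (toPoly K T v) = DFunLike.coe (F := T →₀ K) v γ := by
  classical
  have : lcoeff K γ.1 ∘ₗ toPoly K T = (Finsupp.lapply γ : (T →₀ K) →ₗ[K] K) :=
    MonomialModule.hom_ext fun α c => by
      rw [LinearMap.comp_apply, toPoly_mono, lcoeff_apply, coeff_monomial]
      refine Eq.trans ?_ (Finsupp.single_apply (a := α) (b := c) (a' := γ)).symm
      simp only [Subtype.ext_iff]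
  exact LinearMap.congr_fun this v

theorem MonomialModule.ext_toPoly {v w : MonomialModule K T}
    (h : ∀ γ ∈ T, coeff γ (toPoly K T v) = coeff γ (toPoly K T w)) : v = w :=
  Finsupp.ext fun γ =>
    (coeff_toPoly v γ).symm.trans ((h γ.1 γ.2).trans (coeff_toPoly w γ))

theorem MonomialModule.exists_coeff_toPoly (T : Set (Fin 4 →₀ ℕ)) (h : (Fin 4 →₀ ℕ) → K)
    (hfin : h.support.Finite) :
    ∃ v : MonomialModule K T, ∀ γ ∈ T, coeff γ (toPoly K T v) = h γ := by
  classical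
  let w : T →₀ K := Finsupp.ofSupportFinite (fun γ => h γ.1)
    (hfin.preimage Subtype.val_injective.injOn)
  exact ⟨w, fun γ hγ => coeff_toPoly (T := T) w ⟨γ, hγ⟩⟩

theorem MonomialModule.induction_linear {p : MonomialModule K T → Prop} (v : MonomialModule K T)
    (zero : p 0) (add : ∀ v w, p v → p w → p (v + w)) (mono : ∀ α c, p (mono α c)) : p v :=
  Finsupp.induction_linear (M := K) v zero add mono

theorem MonomialModule.coeff_toPoly_smul [T.OrdConnected] (r : PolyRing4 K)
    (v : MonomialModule K T) {γ : Fin 4 →₀ ℕ} (hγ : γ ∈ T) :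
    coeff γ (toPoly K T (r • v)) = coeff γ (r * toPoly K T v) := by
  classical
  induction r using MvPolynomial.induction_on' with
  | add p q hp hq => rw [add_smul, map_add, coeff_add, hp, hq, add_mul, coeff_add]
  | monomial β b =>
    induction v using MonomialModule.induction_linear with
    | zero => rw [smul_zero, map_zero, mul_zero]
    | add v w hv hw => rw [smul_add, map_add, map_add, mul_add, coeff_add, coeff_add, hv, hw]
    | mono α c =>
      rw [monomial_smul_mono, toPoly_mono, monomial_mul]
      split_ifs with h
      · rw [toPoly_mono]
      · rw [map_zero, coeff_zero, coeff_monomial, if_neg]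
        rintro rfl
        exact h hγ

theorem exists_coeff_eq {σ : Type*} (h : (σ →₀ ℕ) → K) (hfin : h.support.Finite) :
    ∃ p : MvPolynomial σ K, ∀ γ, coeff γ p = h γ := by
  classical
  refine ⟨∑ d ∈ hfin.toFinset, monomial d (h d), fun γ => ?_⟩
  rw [coeff_sum]
  simp only [coeff_monomial]
  rw [Finset.sum_ite_eq']
  split_ifs with hγ
  · rfl
  · simpa [eq_comm] using hγ

end Lift

/-! ### Čech cocycles of `R/I` degree by degree -/

section Gluing

/-- The gluing of the values `gᵢ` of a cocycle in one degree: `pᵢⱼ` says that the monomial does not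
vanish on the overlap of the `i`-th and the `j`-th open set, so that `gᵢ = gⱼ`. The graph on
`{0, 1, 2, 3}` with these edges is connected up to isolated vertices, unless (case `s`) its edges
are `01` and `23`; the other two perfect matchings are excluded. -/
theorem exists_gluing {K : Type*} [AddCommGroup K] {p₀₁ p₀₂ p₀₃ p₁₂ p₁₃ p₂₃ s : Prop}
    [Decidable s] (g : Fin 4 → K) (h₀₁ : p₀₁ → g 0 = g 1) (h₀₂ : p₀₂ → g 0 = g 2)
    (h₀₃ : p₀₃ → g 0 = g 3) (h₁₂ : p₁₂ → g 1 = g 2) (h₁₃ : p₁₃ → g 1 = g 3)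
    (h₂₃ : p₂₃ → g 2 = g 3) (hc : p₀₂ → p₁₃ → p₀₁ ∨ p₂₃) (hc' : p₀₃ → p₁₂ → p₀₁ ∨ p₂₃)
    (hs : s ↔ p₀₁ ∧ p₂₃ ∧ ¬ p₀₂ ∧ ¬ p₀₃ ∧ ¬ p₁₂ ∧ ¬ p₁₃) :
    ∃ m, (g = 0 → m = 0) ∧ (p₀₁ ∨ p₀₂ ∨ p₀₃ → g 0 = m) ∧ (p₀₁ ∨ p₁₂ ∨ p₁₃ → g 1 = m) ∧
      (p₀₂ ∨ p₁₂ ∨ p₂₃ → g 2 = m + if s then g 2 - g 0 else 0) ∧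
      (p₀₃ ∨ p₁₃ ∨ p₂₃ → g 3 = m + if s then g 2 - g 0 else 0) := by
  classical
  refine ⟨if p₀₁ ∨ p₀₂ ∨ p₀₃ then g 0 else if p₁₂ ∨ p₁₃ then g 1 else if p₂₃ then g 2 else 0,
    ?_, ?_, ?_, ?_, ?_⟩
  · rintro rfl
    simp
  all_goals grind

end Gluing

section Tetrahedral

/-- The exponents of the monomials that do not lie in `tetrahedralIdeal K a₁ a₂ a₃ a₄ a₅ a₆`. -/
def IsStandard (a₁ a₂ a₃ a₄ a₅ a₆ : ℕ) (d : Fin 4 →₀ ℕ) : Prop :=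
  d 0 + d 1 < a₁ ∨ d 0 + d 2 < a₂ ∨ d 0 + d 3 < a₃ ∨ d 1 + d 2 < a₄ ∨ d 1 + d 3 < a₅ ∨
    d 2 + d 3 < a₆

variable {K : Type u} [Field K] {a₁ a₂ a₃ a₄ a₅ a₆ : ℕ}

theorem coeff_eq_of_compatible {N : ℕ} {f : Fin 4 → PolyRing4 K}
    (hf : ∀ i j, X i ^ N * f j - X j ^ N * f i ∈ tetrahedralIdeal K a₁ a₂ a₃ a₄ a₅ a₆)
    (i j : Fin 4) {β : Fin 4 →₀ ℕ}
    (hβ : IsStandard a₁ a₂ a₃ a₄ a₅ a₆ (β + Finsupp.single i N + Finsupp.single j N)) :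
    coeff (β + Finsupp.single i N) (f i) = coeff (β + Finsupp.single j N) (f j) := by
  have h := (mem_tetrahedralIdeal_iff _ _ _ _ _ _ _).1 (hf i j) _ hβ
  rw [coeff_sub, coeff_add_single_X_pow_mul, add_right_comm, coeff_add_single_X_pow_mul,
    sub_eq_zero] at h
  exact h.symm

theorem coeff_eq_zero_of_compatible {N : ℕ} {f : Fin 4 → PolyRing4 K}
    (hf : ∀ i j, X i ^ N * f j - X j ^ N * f i ∈ tetrahedralIdeal K a₁ a₂ a₃ a₄ a₅ a₆)
    {i j : Fin 4} (hij : i ≠ j) {δ : Fin 4 →₀ ℕ} (hδ : δ i < N)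
    (hstd : IsStandard a₁ a₂ a₃ a₄ a₅ a₆ (δ + Finsupp.single j N)) : coeff δ (f i) = 0 := by
  have h := (mem_tetrahedralIdeal_iff _ _ _ _ _ _ _).1 (hf i j) _ hstd
  rw [coeff_sub, coeff_add_single_X_pow_mul, coeff_X_pow_mul_of_lt, zero_sub, neg_eq_zero] at h
  · exact h
  · rwa [Finsupp.add_apply, Finsupp.single_eq_of_ne hij, add_zero]

/-- A monomial that is not killed by inverting `xᵢ` is standard with respect to a pair of variables
other than `xᵢ`: the exponent of `xᵢ` may be taken larger than all `aₖ`. -/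
theorem isStandard_of_add_single {i : Fin 4} {δ : Fin 4 →₀ ℕ} {n : ℕ}
    (hn : a₁ + a₂ + a₃ + a₄ + a₅ + a₆ ≤ n)
    (h : IsStandard a₁ a₂ a₃ a₄ a₅ a₆ (δ + Finsupp.single i n)) :
    (i = 0 ∧ (δ 2 + δ 3 < a₆ ∨ δ 1 + δ 3 < a₅ ∨ δ 1 + δ 2 < a₄)) ∨
    (i = 1 ∧ (δ 2 + δ 3 < a₆ ∨ δ 0 + δ 3 < a₃ ∨ δ 0 + δ 2 < a₂)) ∨
    (i = 2 ∧ (δ 1 + δ 3 < a₅ ∨ δ 0 + δ 3 < a₃ ∨ δ 0 + δ 1 < a₁)) ∨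
    (i = 3 ∧ (δ 1 + δ 2 < a₄ ∨ δ 0 + δ 2 < a₂ ∨ δ 0 + δ 1 < a₁)) := by
  fin_cases i <;> simp [IsStandard] at h ⊢ <;> omega

theorem exists_isStandard_add_single {i : Fin 4} {δ : Fin 4 →₀ ℕ} {n : ℕ}
    (hn : a₁ + a₂ + a₃ + a₄ + a₅ + a₆ ≤ n)
    (h : IsStandard a₁ a₂ a₃ a₄ a₅ a₆ (δ + Finsupp.single i n)) (N : ℕ) :
    ∃ j, i ≠ j ∧ IsStandard a₁ a₂ a₃ a₄ a₅ a₆ (δ + Finsupp.single j N) := by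
  rcases isStandard_of_add_single hn h with ⟨rfl, h | h | h⟩ | ⟨rfl, h | h | h⟩ |
    ⟨rfl, h | h | h⟩ | ⟨rfl, h | h | h⟩
  · exact ⟨1, by decide, by simp [IsStandard, h]⟩
  · exact ⟨2, by decide, by simp [IsStandard, h]⟩
  · exact ⟨3, by decide, by simp [IsStandard, h]⟩
  · exact ⟨0, by decide, by simp [IsStandard, h]⟩
  · exact ⟨2, by decide, by simp [IsStandard, h]⟩
  · exact ⟨3, by decide, by simp [IsStandard, h]⟩
  · exact ⟨0, by decide, by simp [IsStandard, h]⟩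
  · exact ⟨1, by decide, by simp [IsStandard, h]⟩
  · exact ⟨3, by decide, by simp [IsStandard, h]⟩
  · exact ⟨0, by decide, by simp [IsStandard, h]⟩
  · exact ⟨1, by decide, by simp [IsStandard, h]⟩
  · exact ⟨2, by decide, by simp [IsStandard, h]⟩

/-- `f / xᵢᴺ = q` holds in the localization of `R/I` at `xᵢ` if the coefficients of `f` and `xᵢᴺ q`
agree at all monomials that are standard after multiplication by a large power of `xᵢ`. -/
theorem quotFrac_eq_of_coeff {i : Fin 4} {N : ℕ} {f q : PolyRing4 K} (n : ℕ)
    (h : ∀ δ, IsStandard a₁ a₂ a₃ a₄ a₅ a₆ (δ + Finsupp.single i n) →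
      coeff δ f = coeff δ (X i ^ N * q)) :
    quotFrac (tetrahedralIdeal K a₁ a₂ a₃ a₄ a₅ a₆) i f N = quotFrac _ i q 0 := by
  rw [← quotFrac_pow_mul _ i q 0 N, add_zero, ← sub_eq_zero, ← quotFrac_sub, quotFrac_eq_zero_iff]
  refine ⟨n, (mem_tetrahedralIdeal_iff _ _ _ _ _ _ _).2 fun γ hγ => ?_⟩
  by_cases hlt : γ i < n
  · exact coeff_X_pow_mul_of_lt hlt _
  · obtain ⟨δ, rfl⟩ := exists_eq_add_single (not_lt.1 hlt)
    rw [coeff_add_single_X_pow_mul, coeff_sub, sub_eq_zero]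
    exact h δ hγ

/-- A cocycle `(fᵢ / xᵢᴺ)ᵢ` of `R/I` is the sum of the coboundary of a polynomial `m` and a cocycle
`(0, 0, p, p)` with `p = ∑ vᵧ xᵞ` supported on the tetrahedral set. The coefficients of `m` and `p`
are found degree by degree. -/
theorem exists_quotFrac_eq (h : max (a₂ + a₅) (a₃ + a₄) ≤ a₁ + a₆) {N : ℕ}
    {f : Fin 4 → PolyRing4 K}
    (hf : ∀ i j, X i ^ N * f j - X j ^ N * f i ∈ tetrahedralIdeal K a₁ a₂ a₃ a₄ a₅ a₆) :
    ∃ (m : PolyRing4 K) (v : MonomialModule K (tetrahedralSet a₁ a₂ a₃ a₄ a₅ a₆)),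
      (∀ γ ∈ tetrahedralSet a₁ a₂ a₃ a₄ a₅ a₆, coeff γ (MonomialModule.toPoly K _ v) =
        coeff (γ + Finsupp.single 2 N) (f 2) - coeff (γ + Finsupp.single 0 N) (f 0)) ∧
      ∀ i, quotFrac (tetrahedralIdeal K a₁ a₂ a₃ a₄ a₅ a₆) i (f i) N =
        quotFrac _ i (m + if i < 2 then 0 else MonomialModule.toPoly K _ v) 0 := by
  classical
  rw [max_le_iff] at h
  let g : (Fin 4 →₀ ℕ) → Fin 4 → K := fun β i => coeff (β + Finsupp.single i N) (f i)
  have hgfin : g.support.Finite := by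
    refine (Set.finite_iUnion fun i => ((f i).support.finite_toSet.preimage
      (add_left_injective (Finsupp.single i N)).injOn)).subset fun β hβ => ?_
    obtain ⟨i, hi⟩ := Function.ne_iff.1 hβ
    exact Set.mem_iUnion.2 ⟨i, mem_support_iff.2 hi⟩
  have hg : ∀ i j β, IsStandard a₁ a₂ a₃ a₄ a₅ a₆
      (β + Finsupp.single i N + Finsupp.single j N) → g β i = g β j :=
    fun i j β hβ => coeff_eq_of_compatible hf i j hβ
  have hglue := fun β : Fin 4 →₀ ℕ => exists_gluing (p₀₁ := β 2 + β 3 < a₆)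
    (p₀₂ := β 1 + β 3 < a₅) (p₀₃ := β 1 + β 2 < a₄) (p₁₂ := β 0 + β 3 < a₃)
    (p₁₃ := β 0 + β 2 < a₂) (p₂₃ := β 0 + β 1 < a₁)
    (s := β ∈ tetrahedralSet a₁ a₂ a₃ a₄ a₅ a₆) (g β)
    (fun hp => hg _ _ _ (by simp [IsStandard, hp]))
    (fun hp => hg _ _ _ (by simp [IsStandard, hp]))
    (fun hp => hg _ _ _ (by simp [IsStandard, hp]))
    (fun hp => hg _ _ _ (by simp [IsStandard, hp]))
    (fun hp => hg _ _ _ (by simp [IsStandard, hp]))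
    (fun hp => hg _ _ _ (by simp [IsStandard, hp]))
    -- here the inequality between the `aᵢ` enters
    (fun h1 h2 => by omega) (fun h1 h2 => by omega)
    (by simp only [tetrahedralSet, Set.mem_ofPred_eq]; omega)
  choose μ hμ₀ hμ using hglue
  obtain ⟨m, hm⟩ := exists_coeff_eq μ (hgfin.subset fun β hβ h0 => hβ (hμ₀ β h0))
  obtain ⟨v, hv⟩ := MonomialModule.exists_coeff_toPoly (K := K)
    (tetrahedralSet a₁ a₂ a₃ a₄ a₅ a₆) (fun β => g β 2 - g β 0)
    (hgfin.subset fun β hβ h0 => hβ (by simp [h0]))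
  have hv' : ∀ β, coeff β (MonomialModule.toPoly K _ v) =
      if β ∈ tetrahedralSet a₁ a₂ a₃ a₄ a₅ a₆ then g β 2 - g β 0 else 0 := fun β => by
    split_ifs with hβ
    · exact hv β hβ
    · exact MonomialModule.coeff_toPoly_of_notMem v hβ
  refine ⟨m, v, hv, fun i => quotFrac_eq_of_coeff (a₁ + a₂ + a₃ + a₄ + a₅ + a₆) fun δ hδ => ?_⟩
  by_cases hlt : δ i < N
  · obtain ⟨j, hij, hj⟩ := exists_isStandard_add_single le_rfl hδ N
    rw [coeff_eq_zero_of_compatible hf hij hlt hj, coeff_X_pow_mul_of_lt hlt]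
  · obtain ⟨β, rfl⟩ := exists_eq_add_single (not_lt.1 hlt)
    rw [coeff_add_single_X_pow_mul, coeff_add, hm]
    rw [add_assoc, ← Finsupp.single_add] at hδ
    obtain ⟨h0, h1, h2, h3⟩ := hμ β
    rcases isStandard_of_add_single (Nat.le_add_left _ N) hδ with ⟨rfl, hp⟩ | ⟨rfl, hp⟩ |
      ⟨rfl, hp⟩ | ⟨rfl, hp⟩
    · rw [if_pos (by decide), coeff_zero, add_zero]
      exact h0 hp
    · rw [if_pos (by decide), coeff_zero, add_zero]
      exact h1 hp
    · rw [if_neg (by decide), hv']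
      exact h2 hp
    · rw [if_neg (by decide), hv']
      exact h3 hp

/-- The cochain `(0, 0, p, p)`. -/
def sideCochain (I : Ideal (PolyRing4 K)) :
    PolyRing4 K →ₗ[PolyRing4 K] CechC1 (quotVar I) where
  toFun p i := quotFrac I i (if i < 2 then 0 else p) 0
  map_add' p q := by
    funext i
    refine Eq.trans ?_ (quotFrac_add I i _ _ 0)
    split_ifs <;> simp
  map_smul' r p := by
    funext i
    refine Eq.trans ?_ (smul_frac r _ _ _).symm
    split_ifs
    · simp only [map_zero, smul_zero, quotFrac]
    · rfl

/-- The cochain `(0, 0, p, p)` is a cocycle since `p` lies in the four primary components of `I` that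
belong to one of `x₁, x₂` and one of `x₃, x₄`, so that a power of `xᵢ xⱼ` times `p` lies in `I` for
`i ∈ {1, 2}` and `j ∈ {3, 4}`. -/
theorem sideCochain_mem_ker {p : PolyRing4 K}
    (hp : ∀ d, coeff d p ≠ 0 → d ∈ tetrahedralSet a₁ a₂ a₃ a₄ a₅ a₆) :
    sideCochain (tetrahedralIdeal K a₁ a₂ a₃ a₄ a₅ a₆) p ∈
      LinearMap.ker (cechD1 (PolyRing4 K) (quotVar (tetrahedralIdeal K a₁ a₂ a₃ a₄ a₅ a₆))) := by
  rw [LinearMap.mem_ker]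
  funext q
  refine (cechD1_frac (R := PolyRing4 K) _ 0 q).trans (frac_eq_zero_iff.2 ⟨a₁ + a₆, ?_⟩)
  obtain ⟨⟨i, j⟩, hij⟩ := q
  simp only [quotVar, pow_zero, one_mul, ← map_sub, ← map_mul, ← map_pow,
    Ideal.Quotient.eq_zero_iff_mem]
  by_cases hside : i < 2 ∧ ¬ j < 2
  · rw [if_neg hside.2, if_pos hside.1, sub_zero, mul_pow, mul_assoc, mem_tetrahedralIdeal_iff]
    intro d hd
    by_cases h1 : d i < a₁ + a₆
    · exact coeff_X_pow_mul_of_lt h1 _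
    obtain ⟨e, rfl⟩ := exists_eq_add_single (not_lt.1 h1)
    rw [coeff_add_single_X_pow_mul]
    by_cases h2 : e j < a₁ + a₆
    · exact coeff_X_pow_mul_of_lt h2 _
    obtain ⟨e, rfl⟩ := exists_eq_add_single (not_lt.1 h2)
    rw [coeff_add_single_X_pow_mul]
    by_contra hne
    obtain ⟨g1, g2, g3, g4, -, -⟩ := hp e hne
    have hi : i = 0 ∨ i = 1 := by omega
    have hj : j = 2 ∨ j = 3 := by omega
    rcases hi with rfl | rfl <;> rcases hj with rfl | rfl <;>
      simp at hd <;> omega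
  · have : (if j < 2 then 0 else p) - (if i < 2 then 0 else p) = 0 := by
      have hij' : i < j := hij
      split_ifs with h1 h2 h2
      · simp
      · omega
      · exact absurd ⟨h2, h1⟩ hside
      · simp
    rw [this, mul_zero]
    exact Ideal.zero_mem _

theorem sideCochain_toPoly_mem_ker (v : MonomialModule K (tetrahedralSet a₁ a₂ a₃ a₄ a₅ a₆)) :
    sideCochain (tetrahedralIdeal K a₁ a₂ a₃ a₄ a₅ a₆) (MonomialModule.toPoly K _ v) ∈
      LinearMap.ker (cechD1 (PolyRing4 K) (quotVar (tetrahedralIdeal K a₁ a₂ a₃ a₄ a₅ a₆))) :=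
  sideCochain_mem_ker fun _ hd => by
    by_contra hne
    exact hd (MonomialModule.coeff_toPoly_of_notMem v hne)

/-- The class of the cocycle `(0, 0, p, p)` for `p = ∑ vᵧ xᵞ`. -/
def sideClass (v : MonomialModule K (tetrahedralSet a₁ a₂ a₃ a₄ a₅ a₆)) :
    QuotCechH1 (tetrahedralIdeal K a₁ a₂ a₃ a₄ a₅ a₆) :=
  Submodule.Quotient.mk ⟨_, sideCochain_toPoly_mem_ker v⟩

/-- Every cocycle `(fᵢ / xᵢᴺ)ᵢ` is cohomologous to a cocycle `(0, 0, p, p)`, and the coefficients of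
`p` are differences of coefficients of the third and the first entry. -/
theorem exists_eq_sideClass (h : max (a₂ + a₅) (a₃ + a₄) ≤ a₁ + a₆)
    (z : LinearMap.ker (cechD1 (PolyRing4 K) (quotVar (tetrahedralIdeal K a₁ a₂ a₃ a₄ a₅ a₆))))
    {N : ℕ} {f : Fin 4 → PolyRing4 K} (hz : ∀ i, z.1 i = quotFrac _ i (f i) N) :
    ∃ v : MonomialModule K (tetrahedralSet a₁ a₂ a₃ a₄ a₅ a₆),
      Submodule.Quotient.mk z = sideClass v ∧
      ∀ γ ∈ tetrahedralSet a₁ a₂ a₃ a₄ a₅ a₆, coeff γ (MonomialModule.toPoly K _ v) =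
        coeff (γ + Finsupp.single 2 N) (f 2) - coeff (γ + Finsupp.single 0 N) (f 0) := by
  obtain ⟨M, hM, hcomp⟩ := exists_compatible z.2 hz
  obtain ⟨m, v, hv, hmv⟩ := exists_quotFrac_eq (N := M + N) (f := fun i => X i ^ M * f i) h
    (fun i j => by
      rw [← Ideal.Quotient.eq]
      simpa only [quotVar, map_mul, map_pow] using hcomp i j)
  refine ⟨v, ?_, fun γ hγ => ?_⟩
  · refine (Submodule.Quotient.eq _).2
      ⟨Ideal.Quotient.mk (tetrahedralIdeal K a₁ a₂ a₃ a₄ a₅ a₆) m, ?_⟩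
    funext i
    have h1 : z.1 i = quotFrac _ i (m + if i < 2 then 0 else MonomialModule.toPoly K _ v) 0 := by
      rw [hz, ← hmv, quotFrac_pow_mul]
    have h2 : z.1 i = quotFrac _ i m 0 + sideCochain _ (MonomialModule.toPoly K _ v) i :=
      h1.trans (quotFrac_add _ _ _ _ _)
    change algebraMap _ _ (Ideal.Quotient.mk (tetrahedralIdeal K a₁ a₂ a₃ a₄ a₅ a₆) m) =
      z.1 i - sideCochain _ (MonomialModule.toPoly K _ v) i
    rw [h2, add_sub_cancel_right, ← frac_self_pow_mul _ _ 0, pow_zero, one_mul]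
  · rw [hv γ hγ, add_comm M N, Finsupp.single_add, Finsupp.single_add, ← add_assoc, ← add_assoc,
      coeff_add_single_X_pow_mul, coeff_add_single_X_pow_mul]

theorem sideClass_injective :
    Function.Injective (sideClass (K := K) (a₁ := a₁) (a₂ := a₂) (a₃ := a₃) (a₄ := a₄) (a₅ := a₅)
      (a₆ := a₆)) := by
  intro v w hvw
  obtain ⟨m', hm'⟩ := (Submodule.Quotient.eq _).1 hvw
  obtain ⟨m, rfl⟩ := Ideal.Quotient.mk_surjective m'
  set p := MonomialModule.toPoly K _ v - MonomialModule.toPoly K _ w with hp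
  have hm : ∀ i, quotFrac (tetrahedralIdeal K a₁ a₂ a₃ a₄ a₅ a₆) i
      (m - if i < 2 then 0 else p) 0 = 0 := by
    intro i
    have h1 : cechD0 (PolyRing4 K) (quotVar (tetrahedralIdeal K a₁ a₂ a₃ a₄ a₅ a₆))
        (Ideal.Quotient.mk _ m) = sideCochain _ p := hm'.trans (map_sub _ _ _).symm
    have h2 : algebraMap _ (Localization.Away (quotVar (tetrahedralIdeal K a₁ a₂ a₃ a₄ a₅ a₆) i))
        (Ideal.Quotient.mk (tetrahedralIdeal K a₁ a₂ a₃ a₄ a₅ a₆) m) =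
        quotFrac _ i (if i < 2 then 0 else p) 0 := congrFun h1 i
    rw [quotFrac_sub, sub_eq_zero, ← h2, quotFrac, ← frac_self_pow_mul _ _ 0, pow_zero, one_mul]
  -- in degree `γ ∈ S`, the section `m` vanishes at `i = 0` and equals `p` at `i = 2`
  have key : ∀ i, ∀ γ, (∀ k, IsStandard a₁ a₂ a₃ a₄ a₅ a₆ (γ + Finsupp.single i k)) →
      coeff γ (m - if i < 2 then 0 else p) = 0 := by
    intro i γ hγ
    obtain ⟨k, hk⟩ := quotFrac_eq_zero_iff.1 (hm i)
    have := (mem_tetrahedralIdeal_iff _ _ _ _ _ _ _).1 hk _ (hγ k)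
    rwa [coeff_add_single_X_pow_mul] at this
  refine MonomialModule.ext_toPoly fun γ hγ => ?_
  have h0 := key 0 γ fun k => by simp [IsStandard, hγ.2.2.2.2.2]
  have h2 := key 2 γ fun k => by simp [IsStandard, hγ.2.2.2.2.1]
  rw [if_pos (by decide), sub_zero] at h0
  rw [if_neg (by decide), coeff_sub, h0, zero_sub, neg_eq_zero, hp, coeff_sub, sub_eq_zero] at h2
  exact h2

theorem sideClass_add (v w : MonomialModule K (tetrahedralSet a₁ a₂ a₃ a₄ a₅ a₆)) :
    sideClass (v + w) = sideClass v + sideClass w := by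
  have h : (⟨_, sideCochain_toPoly_mem_ker (v + w)⟩ : LinearMap.ker (cechD1 (PolyRing4 K)
      (quotVar (tetrahedralIdeal K a₁ a₂ a₃ a₄ a₅ a₆)))) =
      ⟨_, sideCochain_toPoly_mem_ker v⟩ + ⟨_, sideCochain_toPoly_mem_ker w⟩ :=
    Subtype.ext ((congrArg _ (map_add _ v w)).trans (map_add _ _ _))
  rw [sideClass, h, Submodule.Quotient.mk_add]
  rfl

theorem sideClass_smul (h : max (a₂ + a₅) (a₃ + a₄) ≤ a₁ + a₆) (r : PolyRing4 K)
    (v : MonomialModule K (tetrahedralSet a₁ a₂ a₃ a₄ a₅ a₆)) :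
    sideClass (r • v) = r • sideClass v := by
  obtain ⟨w, hw, hcoeff⟩ := exists_eq_sideClass h
    (r • ⟨_, sideCochain_toPoly_mem_ker v⟩) (N := 0)
    (f := fun i => if i < 2 then 0 else r * MonomialModule.toPoly K _ v)
    (fun i => congrFun ((sideCochain _).map_smul r (MonomialModule.toPoly K _ v)).symm i)
  -- `w` and `r • v` both have the coefficients of `r * p` on the tetrahedral set
  have hrv : r • v = w := MonomialModule.ext_toPoly fun γ hγ => by
    rw [MonomialModule.coeff_toPoly_smul r v hγ, hcoeff γ hγ, if_neg (by decide),
      if_pos (by decide), coeff_zero, sub_zero, Finsupp.single_zero, add_zero]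
  rw [hrv, ← hw, Submodule.Quotient.mk_smul]
  rfl

theorem sideClass_surjective (h : max (a₂ + a₅) (a₃ + a₄) ≤ a₁ + a₆) :
    Function.Surjective (sideClass (K := K) (a₁ := a₁) (a₂ := a₂) (a₃ := a₃) (a₄ := a₄) (a₅ := a₅)
      (a₆ := a₆)) := by
  intro q
  obtain ⟨z, rfl⟩ := Submodule.Quotient.mk_surjective _ q
  obtain ⟨N, a, ha⟩ := exists_frac_common z.1
  choose f hf using fun i => Ideal.Quotient.mk_surjective (a i)
  have hz : ∀ i, z.1 i = quotFrac _ i (f i) N := fun i => by rw [ha, quotFrac, hf]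
  obtain ⟨v, hv, -⟩ := exists_eq_sideClass h z hz
  exact ⟨v, hv.symm⟩

/-- The isomorphism `K[S] ≅ H¹` that sends `xᵞ` to the class of `(0, 0, xᵞ, xᵞ)`. -/
def sideClassEquiv (h : max (a₂ + a₅) (a₃ + a₄) ≤ a₁ + a₆) :
    MonomialModule K (tetrahedralSet a₁ a₂ a₃ a₄ a₅ a₆) ≃ₗ[PolyRing4 K]
      QuotCechH1 (tetrahedralIdeal K a₁ a₂ a₃ a₄ a₅ a₆) :=
  LinearEquiv.ofBijective
    ({ toFun := sideClass
       map_add' := sideClass_add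
       map_smul' := sideClass_smul h } :
      MonomialModule K (tetrahedralSet a₁ a₂ a₃ a₄ a₅ a₆) →ₗ[PolyRing4 K]
        QuotCechH1 (tetrahedralIdeal K a₁ a₂ a₃ a₄ a₅ a₆))
    ⟨sideClass_injective, sideClass_surjective h⟩

end Tetrahedral

/-! ### The gradings -/

section Gradings

variable {K : Type u} [Field K] {a₁ a₂ a₃ a₄ a₅ a₆ : ℕ}

/-- Every monomial of the numerator `p` of `p / xᵢᴺ` has degree `α + N eᵢ`. -/
def IsHomogeneousNumerator (i : Fin 4) (α : Fin 4 → ℤ) (N : ℕ) (p : PolyRing4 K) : Prop :=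
  ∀ d, coeff d p ≠ 0 → ∀ j, (d j : ℤ) - (if j = i then (N : ℤ) else 0) = α j

theorem IsHomogeneousNumerator.add {i : Fin 4} {α : Fin 4 → ℤ} {N : ℕ} {p q : PolyRing4 K}
    (hp : IsHomogeneousNumerator i α N p) (hq : IsHomogeneousNumerator i α N q) :
    IsHomogeneousNumerator i α N (p + q) := by
  intro d hd
  by_cases h : coeff d p = 0
  · exact hq d fun h' => hd (by rw [coeff_add, h, h', add_zero])
  · exact hp d h

theorem IsHomogeneousNumerator.X_pow_mul {i : Fin 4} {α : Fin 4 → ℤ} {N : ℕ} {p : PolyRing4 K}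
    (hp : IsHomogeneousNumerator i α N p) (M : ℕ) :
    IsHomogeneousNumerator i α (M + N) (X i ^ M * p) := by
  intro d hd j
  by_cases hlt : d i < M
  · exact absurd (coeff_X_pow_mul_of_lt hlt p) hd
  · obtain ⟨e, rfl⟩ := exists_eq_add_single (not_lt.1 hlt)
    rw [coeff_add_single_X_pow_mul] at hd
    rw [← hp e hd j, Finsupp.add_apply, Finsupp.single_apply]
    by_cases hij : j = i
    · subst hij
      simp
      ring
    · simp [hij, Ne.symm hij]

theorem exists_isHomogeneousNumerator {I : Ideal (PolyRing4 K)} {i : Fin 4} {α : Fin 4 → ℤ}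
    {z : Localization.Away (quotVar I i)} (hz : z ∈ awayComponent I i α) :
    ∃ N p, z = quotFrac I i p N ∧ IsHomogeneousNumerator i α N p := by
  classical
  induction hz using Submodule.span_induction with
  | mem z hz =>
    obtain ⟨k, β, hβ, rfl⟩ := hz
    refine ⟨k, monomial β 1, rfl, fun d hd => ?_⟩
    rw [coeff_monomial] at hd
    obtain rfl : β = d := by
      by_contra hne
      exact hd (if_neg hne)
    exact hβ
  | zero =>
    exact ⟨0, 0, by rw [quotFrac, map_zero, frac_zero], fun d hd => absurd (coeff_zero d) hd⟩
  | add z w _ _ hz hw =>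
    obtain ⟨N, p, rfl, hp⟩ := hz
    obtain ⟨M, q, rfl, hq⟩ := hw
    refine ⟨M + N, X i ^ M * p + X i ^ N * q, ?_, (hp.X_pow_mul M).add ?_⟩
    · rw [quotFrac_add, quotFrac_pow_mul, add_comm M N, quotFrac_pow_mul]
    · rw [add_comm M N]
      exact hq.X_pow_mul N
  | smul c z _ hz =>
    obtain ⟨N, p, rfl, hp⟩ := hz
    refine ⟨N, c • p, smul_frac c _ _ _, fun d hd => hp d fun h0 => hd ?_⟩
    rw [coeff_smul, h0, smul_zero]

theorem exists_isHomogeneousNumerator_common {I : Ideal (PolyRing4 K)} {α : Fin 4 → ℤ}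
    {z : CechC1 (quotVar I)} (hz : ∀ i, z i ∈ awayComponent I i α) :
    ∃ (N : ℕ) (f : Fin 4 → PolyRing4 K), ∀ i, z i = quotFrac I i (f i) N ∧
      IsHomogeneousNumerator i α N (f i) := by
  choose k p hp hp' using fun i => exists_isHomogeneousNumerator (hz i)
  refine ⟨∑ i, k i, fun i => X i ^ (∑ j, k j - k i) * p i, fun i => ?_⟩
  have hk : k i ≤ ∑ j, k j :=
    Finset.single_le_sum (fun j _ => Nat.zero_le (k j)) (Finset.mem_univ i)
  have h1 := quotFrac_pow_mul I i (p i) (k i) (∑ j, k j - k i)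
  have h2 := (hp' i).X_pow_mul (∑ j, k j - k i)
  rw [Nat.sub_add_cancel hk] at h1 h2
  exact ⟨(hp i).trans h1.symm, h2⟩

theorem MonomialModule.mem_component_of_coeff {T : Set (Fin 4 →₀ ℕ)} {α : Fin 4 → ℤ}
    {v : MonomialModule K T}
    (hv : ∀ γ ∈ T, coeff γ (toPoly K T v) ≠ 0 → ∀ j, (γ j : ℤ) = α j) : v ∈ component K T α := by
  have hsum : v = ∑ γ ∈ (show T →₀ K from v).support,
      mono γ ((show T →₀ K from v) γ) := (Finsupp.sum_single (M := K) v).symm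
  rw [hsum]
  refine Submodule.sum_mem _ fun γ hγ => ?_
  have h1 : mono γ ((show T →₀ K from v) γ) =
      ((show T →₀ K from v) γ) • (mono γ 1 : MonomialModule K T) := by
    rw [← map_smul, smul_eq_mul, mul_one]
  rw [h1]
  refine Submodule.smul_mem _ _ (Submodule.subset_span ⟨γ, hv γ.1 γ.2 ?_, rfl⟩)
  rw [coeff_toPoly]
  exact Finsupp.mem_support_iff.1 hγ

theorem sideClass_smul_field (c : K)
    (v : MonomialModule K (tetrahedralSet a₁ a₂ a₃ a₄ a₅ a₆)) :
    sideClass (c • v) = c • sideClass v := by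
  have h : (⟨_, sideCochain_toPoly_mem_ker (c • v)⟩ : LinearMap.ker (cechD1 (PolyRing4 K)
      (quotVar (tetrahedralIdeal K a₁ a₂ a₃ a₄ a₅ a₆)))) =
      c • ⟨_, sideCochain_toPoly_mem_ker v⟩ :=
    Subtype.ext ((congrArg _ (map_smul _ c v)).trans (LinearMap.map_smul_of_tower _ c _))
  rw [sideClass, h, Submodule.Quotient.mk_smul]
  rfl

theorem sideClass_mem_quotCechComponent_iff (h : max (a₂ + a₅) (a₃ + a₄) ≤ a₁ + a₆)
    (α : Fin 4 → ℤ) (v : MonomialModule K (tetrahedralSet a₁ a₂ a₃ a₄ a₅ a₆)) :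
    sideClass v ∈ quotCechComponent (tetrahedralIdeal K a₁ a₂ a₃ a₄ a₅ a₆) α ↔
      v ∈ MonomialModule.component K (tetrahedralSet a₁ a₂ a₃ a₄ a₅ a₆) α := by
  constructor
  · rintro ⟨z, hz, hzv⟩
    obtain ⟨N, f, hf⟩ := exists_isHomogeneousNumerator_common hz
    obtain ⟨w, hw, hcoeff⟩ := exists_eq_sideClass h z fun i => (hf i).1
    obtain rfl : v = w := sideClass_injective (hzv.symm.trans hw)
    refine MonomialModule.mem_component_of_coeff fun γ hγ hne j => ?_
    rw [hcoeff γ hγ] at hne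
    have key : ∀ i, coeff (γ + Finsupp.single i N) (f i) ≠ 0 → (γ j : ℤ) = α j := fun i hi => by
      rw [← (hf i).2 _ hi j, Finsupp.add_apply, Finsupp.single_apply]
      by_cases hij : j = i
      · simp [hij]
      · simp [hij, Ne.symm hij]
    by_cases h2 : coeff (γ + Finsupp.single 2 N) (f 2) = 0
    · exact key 0 fun h0 => hne (by rw [h2, h0, sub_zero])
    · exact key 2 h2
  · intro hv
    induction hv using Submodule.span_induction with
    | mem v hv =>
      obtain ⟨β, hβ, rfl⟩ := hv
      refine ⟨⟨_, sideCochain_toPoly_mem_ker _⟩, fun i => ?_, rfl⟩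
      change quotFrac _ i (if i < 2 then 0 else MonomialModule.toPoly K _ _) 0 ∈ _
      split_ifs
      · rw [quotFrac, map_zero, frac_zero]
        exact Submodule.zero_mem _
      · rw [MonomialModule.toPoly_mono]
        exact Submodule.subset_span ⟨0, β.1, fun j => by simp [hβ j], rfl⟩
    | zero =>
      have h0 : sideClass (0 : MonomialModule K (tetrahedralSet a₁ a₂ a₃ a₄ a₅ a₆)) = 0 :=
        (sideClassEquiv h).map_zero
      rw [h0]
      exact Submodule.zero_mem _
    | add v w _ _ hv hw =>
      rw [sideClass_add]
      exact Submodule.add_mem _ hv hw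
    | smul c v _ hv =>
      rw [sideClass_smul_field]
      exact Submodule.smul_mem _ c hv

/-- The bijection `sideClass` as an isomorphism of vector spaces. -/
def sideClassFieldEquiv (h : max (a₂ + a₅) (a₃ + a₄) ≤ a₁ + a₆) :
    MonomialModule K (tetrahedralSet a₁ a₂ a₃ a₄ a₅ a₆) ≃ₗ[K]
      QuotCechH1 (tetrahedralIdeal K a₁ a₂ a₃ a₄ a₅ a₆) :=
  LinearEquiv.ofBijective
    ({ toFun := sideClass
       map_add' := sideClass_add
       map_smul' := sideClass_smul_field } :
      MonomialModule K (tetrahedralSet a₁ a₂ a₃ a₄ a₅ a₆) →ₗ[K]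
        QuotCechH1 (tetrahedralIdeal K a₁ a₂ a₃ a₄ a₅ a₆))
    ⟨sideClass_injective, sideClass_surjective h⟩

/-- A linear bijection that identifies two `ℤ⁴`-gradings identifies the gradings by total
degree. -/
theorem mem_totalComponent_iff {M M' : Type u} [AddCommGroup M] [Module K M] [AddCommGroup M']
    [Module K M'] {𝓜 : (Fin 4 → ℤ) → Submodule K M} {𝓜' : (Fin 4 → ℤ) → Submodule K M'}
    (e : M ≃ₗ[K] M') (he : ∀ α m, e m ∈ 𝓜' α ↔ m ∈ 𝓜 α) (d : ℤ) (m : M) :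
    e m ∈ totalComponent 𝓜' d ↔ m ∈ totalComponent 𝓜 d := by
  have h1 : ∀ α, 𝓜' α = (𝓜 α).map e.toLinearMap := fun α => by
    ext m'
    obtain ⟨m, rfl⟩ := e.surjective m'
    rw [he]
    exact ⟨fun hm => ⟨m, hm, rfl⟩, fun ⟨_, hx, hxe⟩ => e.injective hxe ▸ hx⟩
  have h2 : totalComponent 𝓜' d = (totalComponent 𝓜 d).map e.toLinearMap := by
    simp only [totalComponent, h1, Submodule.map_iSup]
  rw [h2]
  exact ⟨fun ⟨_, hx, hxe⟩ => e.injective hxe ▸ hx, fun hm => ⟨m, hm, rfl⟩⟩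

theorem sideClass_mem_totalComponent_iff (h : max (a₂ + a₅) (a₃ + a₄) ≤ a₁ + a₆) (d : ℤ)
    (v : MonomialModule K (tetrahedralSet a₁ a₂ a₃ a₄ a₅ a₆)) :
    sideClass v ∈ totalComponent
        (quotCechComponent (tetrahedralIdeal K a₁ a₂ a₃ a₄ a₅ a₆)) d ↔
      v ∈ totalComponent
        (MonomialModule.component K (tetrahedralSet a₁ a₂ a₃ a₄ a₅ a₆)) d := by
  have he : ∀ α v, sideClassFieldEquiv (K := K) h v ∈
      quotCechComponent (tetrahedralIdeal K a₁ a₂ a₃ a₄ a₅ a₆) α ↔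
      v ∈ MonomialModule.component K (tetrahedralSet a₁ a₂ a₃ a₄ a₅ a₆) α := fun α v =>
    sideClass_mem_quotCechComponent_iff h α v
  have := mem_totalComponent_iff (sideClassFieldEquiv h) he d v
  exact this

end Gradings

end

theorem proposition3p3 {K : Type u} [Field K] (a₁ a₂ a₃ a₄ a₅ a₆ : ℕ)
    (h : max (a₂ + a₅) (a₃ + a₄) ≤ a₁ + a₆) :
    -- the local cohomology module is computed by the Čech complex, which grades it
    Nonempty (LocalH1 (tetrahedralIdeal K a₁ a₂ a₃ a₄ a₅ a₆) ≃ₗ[PolyRing4 K]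
      QuotCechH1 (tetrahedralIdeal K a₁ a₂ a₃ a₄ a₅ a₆)) ∧
    -- and with any grading transported in this way it is isomorphic to `K[S]`
    ∀ φ : LocalH1 (tetrahedralIdeal K a₁ a₂ a₃ a₄ a₅ a₆) ≃ₗ[PolyRing4 K]
        QuotCechH1 (tetrahedralIdeal K a₁ a₂ a₃ a₄ a₅ a₆),
      ∃ e : LocalH1 (tetrahedralIdeal K a₁ a₂ a₃ a₄ a₅ a₆) ≃ₗ[PolyRing4 K]
          MonomialModule K (tetrahedralSet a₁ a₂ a₃ a₄ a₅ a₆),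
        (∀ (α : Fin 4 → ℤ) (m : LocalH1 (tetrahedralIdeal K a₁ a₂ a₃ a₄ a₅ a₆)),
          φ m ∈ quotCechComponent (tetrahedralIdeal K a₁ a₂ a₃ a₄ a₅ a₆) α ↔
            e m ∈ MonomialModule.component K (tetrahedralSet a₁ a₂ a₃ a₄ a₅ a₆) α) ∧
        (∀ (d : ℤ) (m : LocalH1 (tetrahedralIdeal K a₁ a₂ a₃ a₄ a₅ a₆)),
          φ m ∈ totalComponent
              (quotCechComponent (tetrahedralIdeal K a₁ a₂ a₃ a₄ a₅ a₆)) d ↔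
            e m ∈ totalComponent
              (MonomialModule.component K (tetrahedralSet a₁ a₂ a₃ a₄ a₅ a₆)) d) := by
  refine ⟨⟨localCohomologyEquivCech fun _ => rfl⟩, fun φ => ⟨φ ≪≫ₗ (sideClassEquiv h).symm, ?_, ?_⟩⟩
  · intro α m
    obtain ⟨v, hv⟩ := (sideClassEquiv h).surjective (φ m)
    rw [LinearEquiv.trans_apply, ← hv, LinearEquiv.symm_apply_apply]
    exact sideClass_mem_quotCechComponent_iff h α v
  · intro d m
    obtain ⟨v, hv⟩ := (sideClassEquiv h).surjective (φ m)
    rw [LinearEquiv.trans_apply, ← hv, LinearEquiv.symm_apply_apply]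
    exact sideClass_mem_totalComponent_iff h d v
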